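/- For a finite group $G$ let $M(G)$ be the monomial ring of $G$: the free abelian group on the $G$-conjugacy classes of symbols $[H,\chi]$, where $H\le G$ and $\chi$ is a complex one-dimensional representation of $H$, with multiplication $$[H,\chi]\cdot[K,\psi]=\sum_{g\in H\backslash G/K}\bigl[H^g\cap K,\ \mathrm{Res}\,\chi^g\cdot\mathrm{Res}\,\psi\bigr],\qquad H^g=g^{-1}Hg,\quad \chi^g(x)=\chi(gxg^{-1}).$$ Let $R_{\mathbb C}(G)$ be the representation ring, i.e. the free abelian group on isomorphism classes of finite-dimensional complex representations of $G$ modulo the relations $[V\oplus W]-[V]-[W]$. Let $K(G)$ be the kernel of the homomorphism $M(G)\to R_{\mathbb C}(G)$ sending $[H,\chi]$ to $[\mathrm{Ind}_H^G\chi]$ (the group of monomial relations). For $H\le G$ let $\mathrm{Ind}_{G/H}\colon M(H)\to M(G)$ be given by $[U,\lambda]\mapsto[U,\lambda]$, and for $N\trianglelefteq G$ with projection $\pi\colon G\to G/N$ let $\mathrm{Inf}_{G/N}\colon M(G/N)\to M(G)$ be given by $[U,\lambda]\mapsto[\pi^{-1}(U),\lambda\circ\pi]$. Let $D(G)\subseteq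 M(G)$ be the subring generated by the symbols $[G,\lambda]$, where $\lambda$ runs over the one-dimensional representations of $G$, and put $$\mathrm{Imprim}_D(G)=D(G)\cdot\Bigl(\sum_{H\lneq G}\mathrm{Ind}_{G/H}K(H)+\sum_{1\ne N\trianglelefteq G}\mathrm{Inf}_{G/N}K(G/N)\Bigr),\qquad \mathrm{Prim}_D(G)=K(G)/\mathrm{Imprim}_D(G).$$ A group is called elementary if it is a direct product of a finite cyclic group and a finite $p$-group for some prime $p$. **Theorem (Deligne--Langlands).** Let $G$ be a finite group that has a non-trivial normal subgroup $N$ such that $G/N$ is not elementary. Then $\mathrm{Imprim}_D(G)$ is contained in $K(G)$, and the primitive quotient $\mathrm{Prim}_D(G)$ is trivial; that is, $K(G)=\mathrm{Imprim}_D(G)$. -/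

import Mathlib

universe u

noncomputable section

/-- A symbol `[H, χ]` before passing to conjugacy classes: a subgroup `H` of `G` together with a
complex one-dimensional representation of `H`, given as a homomorphism `χ : H → ℂˣ`. -/
structure MonomialPair (G : Type u) [Group G] where
  /-- the subgroup -/
  H : Subgroup G
  /-- the one-dimensional representation -/
  χ : H →* ℂˣ

namespace MonomialPair

variable {G : Type u} [Group G]

theorem ext' {p q : MonomialPair G} (h : ∀ x, x ∈ p.H ↔ x ∈ q.H)
    (h' : ∀ x (hp : x ∈ p.H) (hq : x ∈ q.H), p.χ ⟨x, hp⟩ = q.χ ⟨x, hq⟩) : p = q := by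
  obtain ⟨H, χ⟩ := p
  obtain ⟨K, ψ⟩ := q
  obtain rfl : H = K := Subgroup.ext h
  congr
  ext x
  simpa using congrArg Units.val (h' x.1 x.2 x.2)

/-- The pull-back of `(H, χ)` along a homomorphism `f`: the subgroup `f⁻¹(H)` with the
one-dimensional representation `χ ∘ f`. -/
def comap {G' : Type u} [Group G'] (f : G' →* G) (p : MonomialPair G) : MonomialPair G' where
  H := p.H.comap f
  χ := p.χ.comp (f.subgroupComap p.H)

theorem comap_comp {G' G'' : Type u} [Group G'] [Group G''] (f : G' →* G) (f' : G'' →* G')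
    (p : MonomialPair G) : p.comap (f.comp f') = (p.comap f).comap f' := rfl

/-- `G` acts by conjugation: `g • (H, χ) = (g H g⁻¹, x ↦ χ (g⁻¹ x g))`. -/
instance : MulAction G (MonomialPair G) where
  smul g p := p.comap (MulAut.conj g⁻¹).toMonoidHom
  one_smul p := by
    refine ext' (fun x => ?_) (fun x hp hq => ?_)
    · change MulAut.conj (1 : G)⁻¹ x ∈ p.H ↔ _
      simp
    · change p.χ ⟨MulAut.conj (1 : G)⁻¹ x, _⟩ = _
      congr 2
      simp
  mul_smul g h p := by
    change p.comap _ = (p.comap _).comap _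
    rw [← comap_comp]
    congr 1
    ext x
    simp [mul_assoc]

theorem mem_smul (g : G) (p : MonomialPair G) (x : G) : x ∈ (g • p).H ↔ g⁻¹ * x * g ∈ p.H := by
  change MulAut.conj g⁻¹ x ∈ p.H ↔ _
  simp

theorem smul_χ (g : G) (p : MonomialPair G) (x : G) (hx : x ∈ (g • p).H) :
    (g • p).χ ⟨x, hx⟩ = p.χ ⟨g⁻¹ * x * g, (mem_smul g p x).1 hx⟩ := by
  change p.χ ⟨MulAut.conj g⁻¹ x, _⟩ = _
  congr 2
  simp

/-- The pair `(H ∩ K, Res χ · Res ψ)` attached to `(H, χ)` and `(K, ψ)`. -/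
def meet (p q : MonomialPair G) : MonomialPair G where
  H := p.H ⊓ q.H
  χ := p.χ.comp (Subgroup.inclusion inf_le_left) * q.χ.comp (Subgroup.inclusion inf_le_right)

theorem mem_meet (p q : MonomialPair G) (x : G) : x ∈ (p.meet q).H ↔ x ∈ p.H ∧ x ∈ q.H :=
  Iff.rfl

theorem meet_χ (p q : MonomialPair G) (x : G) (hx : x ∈ (p.meet q).H) :
    (p.meet q).χ ⟨x, hx⟩ = p.χ ⟨x, hx.1⟩ * q.χ ⟨x, hx.2⟩ := rfl

theorem meet_comm (p q : MonomialPair G) : p.meet q = q.meet p :=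
  ext' (fun x => by simp only [mem_meet]; tauto) (fun x hp hq => by simp only [meet_χ, mul_comm])

theorem meet_assoc (p q r : MonomialPair G) : (p.meet q).meet r = p.meet (q.meet r) :=
  ext' (fun x => by simp only [mem_meet]; tauto) (fun x hp hq => by simp only [meet_χ, mul_assoc])

theorem smul_meet (g : G) (p q : MonomialPair G) : g • (p.meet q) = (g • p).meet (g • q) :=
  ext' (fun x => by simp only [mem_meet, mem_smul])
    (fun x hp hq => by simp only [meet_χ, smul_χ])

theorem smul_self_of_mem (p : MonomialPair G) {h : G} (hh : h ∈ p.H) : h • p = p := by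
  refine ext' (fun x => ?_) (fun x hp hq => ?_)
  · rw [mem_smul, p.H.mul_mem_cancel_right hh, p.H.mul_mem_cancel_left (p.H.inv_mem hh)]
  · rw [smul_χ]
    have : (⟨h⁻¹ * x * h, (mem_smul h p x).1 hp⟩ : p.H)
        = (⟨h, hh⟩ : p.H)⁻¹ * ⟨x, hq⟩ * ⟨h, hh⟩ := rfl
    rw [this, map_mul, map_mul, map_inv, mul_comm, mul_inv_cancel_left]

/-- The pair `(G, χ)`. -/
def full (χ : G →* ℂˣ) : MonomialPair G where
  H := ⊤
  χ := χ.comp (⊤ : Subgroup G).subtype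

theorem full_one_meet (p : MonomialPair G) : (full 1).meet p = p :=
  ext' (fun x => by simp [mem_meet, full]) (fun x hp hq => by
    rw [meet_χ]
    exact one_mul _)

/-- Conjugacy classes of pairs. -/
abbrev Cls (G : Type u) [Group G] : Type u := MulAction.orbitRel.Quotient G (MonomialPair G)

/-- The conjugacy class of a pair. -/
def cls (p : MonomialPair G) : Cls G := Quotient.mk _ p

theorem cls_smul (g : G) (p : MonomialPair G) : (g • p).cls = p.cls :=
  Quotient.sound ⟨g, rfl⟩

/-- The image of a pair `(K, ψ)` of a subgroup `H ≤ G` in `G`: the subgroup `K` viewed in `G`,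
with the same one-dimensional representation. -/
def ofSubgroup (H : Subgroup G) (p : MonomialPair H) : MonomialPair G where
  H := p.H.map H.subtype
  χ := p.χ.comp (p.H.equivMapOfInjective H.subtype H.subtype_injective).symm.toMonoidHom

theorem mem_ofSubgroup (H : Subgroup G) (p : MonomialPair H) (x : G) :
    x ∈ (p.ofSubgroup H).H ↔ ∃ h : x ∈ H, ⟨x, h⟩ ∈ p.H := by
  simp [ofSubgroup]

theorem ofSubgroup_χ (H : Subgroup G) (p : MonomialPair H) (x : H) (hx : x ∈ p.H)
    (hx' : (x : G) ∈ (p.ofSubgroup H).H) : (p.ofSubgroup H).χ ⟨x, hx'⟩ = p.χ ⟨x, hx⟩ := by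
  change p.χ ((p.H.equivMapOfInjective H.subtype H.subtype_injective).symm _) = _
  congr 1
  exact (MulEquiv.symm_apply_eq _).2 rfl

theorem ofSubgroup_smul (H : Subgroup G) (h : H) (p : MonomialPair H) :
    (h • p).ofSubgroup H = (h : G) • p.ofSubgroup H := by
  have key : ∀ x : G, ∀ hx : x ∈ H, (h : G)⁻¹ * x * h = ((h⁻¹ * ⟨x, hx⟩ * h : H) : G) :=
    fun _ _ => rfl
  refine ext' (fun x => ?_) (fun x hp hq => ?_)
  · rw [mem_smul, mem_ofSubgroup, mem_ofSubgroup]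
    constructor
    · rintro ⟨hx, hm⟩
      exact ⟨H.mul_mem (H.mul_mem (H.inv_mem h.2) hx) h.2, (mem_smul _ _ _).1 hm⟩
    · rintro ⟨hx, hm⟩
      have hx' : x ∈ H := by
        rwa [H.mul_mem_cancel_right h.2, H.mul_mem_cancel_left (H.inv_mem h.2)] at hx
      exact ⟨hx', (mem_smul _ _ _).2 hm⟩
  · obtain ⟨hx, hm⟩ := (mem_ofSubgroup _ _ _).1 hp
    rw [smul_χ, ofSubgroup_χ H (h • p) ⟨x, hx⟩ hm, smul_χ]
    exact (ofSubgroup_χ H p (h⁻¹ * ⟨x, hx⟩ * h) ((mem_smul _ _ _).1 hm) _).symm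

theorem comap_smul {G' : Type u} [Group G'] (f : G' →* G) (g : G') (p : MonomialPair G) :
    (f g • p).comap f = g • p.comap f := by
  change (p.comap _).comap _ = (p.comap _).comap _
  rw [← comap_comp, ← comap_comp]
  congr 1
  ext x
  simp

end MonomialPair

open MonomialPair

/-- The monomial ring `M(G)`, as an abelian group: it is free on the conjugacy classes of
symbols `[H, χ]`. The ring structure is defined below. -/
def MonomialRing (G : Type u) [Group G] : Type u := FreeAbelianGroup (MonomialPair.Cls G)

namespace MonomialRing

section Group

variable {G : Type u} [Group G]

instance : AddCommGroup (MonomialRing G) :=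
  inferInstanceAs (AddCommGroup (FreeAbelianGroup (MonomialPair.Cls G)))

/-- The basis element `[H, χ]` of `M(G)`. -/
def symb (p : MonomialPair G) : MonomialRing G := FreeAbelianGroup.of p.cls

theorem symb_smul (g : G) (p : MonomialPair G) : symb (g • p) = symb p :=
  congrArg FreeAbelianGroup.of (cls_smul g p)

/-- The homomorphism out of `M(G)` given by a conjugation invariant function on pairs. -/
def lift {A : Type*} [AddCommGroup A] (f : MonomialPair G → A)
    (hf : ∀ (g : G) (p : MonomialPair G), f (g • p) = f p) : MonomialRing G →+ A :=
  FreeAbelianGroup.lift (Quotient.lift f (by rintro _ q ⟨g, rfl⟩; exact hf g q))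

@[simp]
theorem lift_symb {A : Type*} [AddCommGroup A] (f : MonomialPair G → A)
    (hf : ∀ (g : G) (p : MonomialPair G), f (g • p) = f p) (p : MonomialPair G) :
    lift f hf (symb p) = f p :=
  FreeAbelianGroup.lift_apply_of _ _

theorem hom_ext {A : Type*} [AddCommGroup A] {f f' : MonomialRing G →+ A}
    (h : ∀ p, f (symb p) = f' (symb p)) : f = f' := by
  refine FreeAbelianGroup.lift_ext _ _ fun c => ?_
  induction c using Quotient.inductionOn with
  | h p => exact h p

theorem torsion_free {n : ℕ} (hn : n ≠ 0) {x y : MonomialRing G} (h : n • x = n • y) : x = y := by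
  let e : MonomialRing G ≃+ (MonomialPair.Cls G →₀ ℤ) := FreeAbelianGroup.equivFinsupp _
  have h1 : n • e x = n • e y := by rw [← map_nsmul, ← map_nsmul, h]
  apply e.injective
  ext c
  have h2 := DFunLike.congr_fun h1 c
  simpa [hn] using h2

/-- The multiple `|H| [H, χ]` of `[H, χ]`. -/
def wsymb (p : MonomialPair G) : MonomialRing G := Nat.card p.H • symb p

theorem card_smul (g : G) (p : MonomialPair G) : Nat.card (g • p).H = Nat.card p.H :=
  Nat.card_congr
    { toFun := fun x => ⟨g⁻¹ * x * g, (mem_smul _ _ _).1 x.2⟩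
      invFun := fun x => ⟨g * x * g⁻¹, (mem_smul _ _ _).2 (by
        have : g⁻¹ * (g * (x : G) * g⁻¹) * g = x := by group
        rw [this]
        exact x.2)⟩
      left_inv := fun x => Subtype.ext (by dsimp only; group)
      right_inv := fun x => Subtype.ext (by dsimp only; group) }

theorem wsymb_smul (g : G) (p : MonomialPair G) : wsymb (g • p) = wsymb p := by
  rw [wsymb, wsymb, card_smul, symb_smul]

/-- The summand `[H^g ∩ K, Res χ^g · Res ψ]`, where `H^g = g⁻¹ H g`, as a function of the double
coset `H g K`. -/
def term (p q : MonomialPair G) :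
    DoubleCoset.Quotient (p.H : Set G) (q.H : Set G) → MonomialRing G :=
  Quotient.lift (fun g => symb ((g⁻¹ • p).meet q)) (by
    intro a b hab
    obtain ⟨h, hh, k, hk, rfl⟩ := DoubleCoset.rel_iff.1 hab
    have : (h * a * k)⁻¹ • p = k⁻¹ • a⁻¹ • p := by
      rw [mul_inv_rev, mul_inv_rev, mul_smul, mul_smul, smul_self_of_mem p (p.H.inv_mem hh)]
    rw [this]
    conv_rhs => rw [← smul_self_of_mem q (q.H.inv_mem hk)]
    rw [← smul_meet, symb_smul])

@[simp]
theorem term_mk (p q : MonomialPair G) (g : G) :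
    term p q (DoubleCoset.mk p.H q.H g) = symb ((g⁻¹ • p).meet q) := rfl

/-- A double coset `H g K` has `|H| |K| / |H^g ∩ K|` elements. -/
theorem card_fiber (p q : MonomialPair G) (g : G) :
    Nat.card {x : G // DoubleCoset.mk p.H q.H x = DoubleCoset.mk p.H q.H g} *
      Nat.card ((g⁻¹ • p).meet q).H = Nat.card p.H * Nat.card q.H := by
  have ex : ∀ x : {x : G // DoubleCoset.mk p.H q.H x = DoubleCoset.mk p.H q.H g},
      ∃ h : p.H, ∃ k : q.H, (x : G) = h * g * k := by
    rintro ⟨x, hx⟩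
    obtain ⟨h, hh, k, hk, e⟩ := (DoubleCoset.eq _ _ _ _).1 hx.symm
    exact ⟨⟨h, hh⟩, ⟨k, hk⟩, e⟩
  choose h k hx using ex
  have hm : ∀ m : ((g⁻¹ • p).meet q).H, g * m * g⁻¹ ∈ p.H := fun m => by
    simpa using (mem_smul _ _ _).1 m.2.1
  rw [← Nat.card_prod, ← Nat.card_prod]
  refine Nat.card_congr (Equiv.ofBijective
    (fun z => (h z.1 * ⟨g * z.2 * g⁻¹, hm z.2⟩, ⟨(z.2 : G), z.2.2.2⟩⁻¹ * k z.1)) ⟨?_, ?_⟩)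
  · rintro ⟨x, m⟩ ⟨x', m'⟩ e
    have e1 : (h x : G) * (g * m * g⁻¹) = h x' * (g * m' * g⁻¹) :=
      congrArg (fun z : p.H × q.H => (z.1 : G)) e
    have e2 : (m : G)⁻¹ * k x = (m' : G)⁻¹ * k x' :=
      congrArg (fun z : p.H × q.H => (z.2 : G)) e
    have e3 : x = x' := by
      apply Subtype.ext
      rw [hx x, hx x']
      calc (h x : G) * g * k x = (h x * (g * m * g⁻¹)) * g * ((m : G)⁻¹ * k x) := by group
        _ = (h x' * (g * m' * g⁻¹)) * g * ((m' : G)⁻¹ * k x') := by rw [e1, e2]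
        _ = _ := by group
    subst e3
    have e4 : (m : G) = m' := by simpa using e2
    rw [Subtype.ext e4]
  · rintro ⟨a, b⟩
    let x : {x : G // DoubleCoset.mk p.H q.H x = DoubleCoset.mk p.H q.H g} :=
      ⟨a * g * b, ((DoubleCoset.eq _ _ _ _).2 ⟨(a : G), a.2, (b : G), b.2, rfl⟩).symm⟩
    have e : (a : G) * g * b = h x * g * k x := hx x
    have e' : (k x : G) * (b : G)⁻¹ = g⁻¹ * ((h x : G)⁻¹ * a) * g := by
      calc (k x : G) * (b : G)⁻¹ = g⁻¹ * (h x : G)⁻¹ * (h x * g * k x) * (b : G)⁻¹ := by group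
        _ = g⁻¹ * (h x : G)⁻¹ * (a * g * b) * (b : G)⁻¹ := by rw [e]
        _ = _ := by group
    let m : ((g⁻¹ • p).meet q).H := ⟨k x * (b : G)⁻¹, by
      refine ⟨(mem_smul _ _ _).2 ?_, q.H.mul_mem (k x).2 (q.H.inv_mem b.2)⟩
      rw [e']
      have : g⁻¹⁻¹ * (g⁻¹ * ((h x : G)⁻¹ * a) * g) * g⁻¹ = (h x : G)⁻¹ * a := by group
      rw [this]
      exact p.H.mul_mem (p.H.inv_mem (h x).2) a.2⟩
    refine ⟨(x, m), Prod.ext (Subtype.ext ?_) (Subtype.ext ?_)⟩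
    · change (h x : G) * (g * (k x * (b : G)⁻¹) * g⁻¹) = a
      rw [e']
      group
    · change ((k x : G) * (b : G)⁻¹)⁻¹ * k x = b
      group

end Group

section Ring

variable {G : Type u} [Group G] [Finite G]

instance (H K : Subgroup G) : Finite (DoubleCoset.Quotient (H : Set G) (K : Set G)) :=
  inferInstanceAs (Finite (Quotient _))

/-- The product of two symbols:
`[H, χ] · [K, ψ] = ∑_{g ∈ H \ G / K} [H^g ∩ K, Res χ^g · Res ψ]`, where `H^g = g⁻¹ H g`. -/
def mulSymb (p q : MonomialPair G) : MonomialRing G := ∑ᶠ d, term p q d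

theorem card_ne_zero (p : MonomialPair G) : Nat.card p.H ≠ 0 := Nat.card_pos.ne'

theorem card_smul_mulSymb [Fintype G] (p q : MonomialPair G) :
    (Nat.card p.H * Nat.card q.H) • mulSymb p q = ∑ g : G, wsymb ((g⁻¹ • p).meet q) := by
  classical
  let _ : Fintype (DoubleCoset.Quotient (p.H : Set G) (q.H : Set G)) := Fintype.ofFinite _
  rw [mulSymb, finsum_eq_sum_of_fintype, Finset.smul_sum,
    ← Finset.sum_fiberwise Finset.univ (fun g => DoubleCoset.mk p.H q.H g)]
  refine Finset.sum_congr rfl fun d _ => ?_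
  obtain ⟨g₀, rfl⟩ : ∃ g, DoubleCoset.mk p.H q.H g = d := ⟨_, DoubleCoset.out_eq' _ _ d⟩
  have hc := card_fiber p q g₀
  have hcard : Nat.card {x : G // DoubleCoset.mk p.H q.H x = DoubleCoset.mk p.H q.H g₀} =
      (Finset.univ.filter fun g => DoubleCoset.mk p.H q.H g = DoubleCoset.mk p.H q.H g₀).card := by
    rw [Nat.card_eq_fintype_card, Fintype.card_subtype]
  rw [← hc, hcard, mul_smul]
  symm
  apply Finset.sum_eq_card_nsmul
  intro g hg
  have hg' : DoubleCoset.mk p.H q.H g = DoubleCoset.mk p.H q.H g₀ := (Finset.mem_filter.1 hg).2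
  have hc' := card_fiber p q g
  rw [hg', ← hc] at hc'
  have hpos : Nat.card {x : G // DoubleCoset.mk p.H q.H x = DoubleCoset.mk p.H q.H g₀} ≠ 0 :=
    haveI : Nonempty {x : G // DoubleCoset.mk p.H q.H x = DoubleCoset.mk p.H q.H g₀} :=
      ⟨⟨g₀, rfl⟩⟩
    Nat.card_pos.ne'
  rw [wsymb, mul_left_cancel₀ hpos hc', ← term_mk, hg']

theorem mulSymb_smul_left (a : G) (p q : MonomialPair G) :
    mulSymb (a • p) q = mulSymb p q := by
  let _ : Fintype G := Fintype.ofFinite G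
  apply torsion_free (mul_ne_zero (card_ne_zero p) (card_ne_zero q))
  conv_lhs => rw [← card_smul a p]
  rw [card_smul_mulSymb, card_smul_mulSymb]
  refine Fintype.sum_equiv (Equiv.mulLeft a⁻¹) _ _ fun g => ?_
  simp [mul_smul]

theorem mulSymb_comm (p q : MonomialPair G) : mulSymb p q = mulSymb q p := by
  let _ : Fintype G := Fintype.ofFinite G
  apply torsion_free (mul_ne_zero (card_ne_zero p) (card_ne_zero q))
  rw [card_smul_mulSymb, mul_comm, card_smul_mulSymb]
  refine Fintype.sum_equiv (Equiv.inv G) _ _ fun g => ?_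
  rw [← wsymb_smul g, smul_meet, smul_inv_smul, meet_comm]
  simp

theorem mulSymb_smul_right (a : G) (p q : MonomialPair G) :
    mulSymb p (a • q) = mulSymb p q := by
  rw [mulSymb_comm, mulSymb_smul_left, mulSymb_comm]

/-- The multiplication of `M(G)`, extended biadditively from symbols. -/
def mulHom : MonomialRing G →+ MonomialRing G →+ MonomialRing G :=
  lift (fun p => lift (fun q => mulSymb p q) fun g q => mulSymb_smul_right g p q)
    fun g p => hom_ext fun q => by simp only [lift_symb, mulSymb_smul_left]

theorem mulHom_symb (p q : MonomialPair G) : mulHom (symb p) (symb q) = mulSymb p q := by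
  simp only [mulHom, lift_symb]

theorem mulHom_wsymb [Fintype G] (p q : MonomialPair G) :
    mulHom (wsymb p) (wsymb q) = ∑ g : G, wsymb ((g⁻¹ • p).meet q) := by
  rw [← card_smul_mulSymb, wsymb, wsymb, map_nsmul, map_nsmul, AddMonoidHom.nsmul_apply,
    mulHom_symb, mul_smul, smul_comm]

theorem mulHom_comm (x y : MonomialRing G) : mulHom x y = mulHom y x := by
  have : (mulHom : MonomialRing G →+ _) = mulHom.flip :=
    hom_ext fun p => hom_ext fun q => by
      rw [AddMonoidHom.flip_apply, mulHom_symb, mulHom_symb, mulSymb_comm]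
  exact DFunLike.congr_fun (DFunLike.congr_fun this x) y

theorem mulHom_assoc_wsymb (p q r : MonomialPair G) :
    mulHom (mulHom (wsymb p) (wsymb q)) (wsymb r) =
      mulHom (wsymb p) (mulHom (wsymb q) (wsymb r)) := by
  let _ : Fintype G := Fintype.ofFinite G
  simp only [mulHom_wsymb, map_sum, AddMonoidHom.finsetSum_apply]
  rw [Finset.sum_comm]
  refine Finset.sum_congr rfl fun h _ => ?_
  refine Fintype.sum_equiv (Equiv.mulRight h) _ _ fun g => ?_
  rw [smul_meet, meet_assoc]
  simp [mul_smul]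

theorem mulHom_assoc (x y z : MonomialRing G) :
    mulHom (mulHom x y) z = mulHom x (mulHom y z) := by
  have key : ∀ p q r : MonomialPair G, mulHom (mulHom (symb p) (symb q)) (symb r) =
      mulHom (symb p) (mulHom (symb q) (symb r)) := by
    intro p q r
    apply torsion_free (card_ne_zero p)
    apply torsion_free (card_ne_zero q)
    apply torsion_free (card_ne_zero r)
    simpa only [wsymb, map_nsmul, AddMonoidHom.nsmul_apply] using mulHom_assoc_wsymb p q r
  have h1 : ∀ p q, mulHom (mulHom (symb p) (symb q)) =
      (mulHom (symb p)).comp (mulHom (symb q)) := fun p q => hom_ext fun r => by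
    rw [AddMonoidHom.comp_apply]
    exact key p q r
  have h2 : ∀ p, mulHom (mulHom (symb p) y) z = mulHom (symb p) (mulHom y z) := by
    intro p
    have : (mulHom.flip z).comp (mulHom (symb p)) = (mulHom (symb p)).comp (mulHom.flip z) := by
      refine hom_ext fun q => ?_
      simp only [AddMonoidHom.comp_apply, AddMonoidHom.flip_apply, h1]
    simpa only [AddMonoidHom.comp_apply, AddMonoidHom.flip_apply] using DFunLike.congr_fun this y
  have h3 : (mulHom.flip z).comp (mulHom.flip y) = mulHom.flip (mulHom y z) := by
    refine hom_ext fun p => ?_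
    simp only [AddMonoidHom.comp_apply, AddMonoidHom.flip_apply, h2]
  simpa only [AddMonoidHom.comp_apply, AddMonoidHom.flip_apply] using DFunLike.congr_fun h3 x

theorem one_mulHom (x : MonomialRing G) : mulHom (symb (full 1)) x = x := by
  let _ : Fintype G := Fintype.ofFinite G
  have : mulHom (symb (full 1)) = AddMonoidHom.id (MonomialRing G) := hom_ext fun q => by
    apply torsion_free (card_ne_zero (full (1 : G →* ℂˣ)))
    apply torsion_free (card_ne_zero q)
    have h := mulHom_wsymb (full (1 : G →* ℂˣ)) q
    have h1 : ∀ g : G, wsymb ((g⁻¹ • full (1 : G →* ℂˣ)).meet q) = wsymb q := fun g => by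
      rw [smul_self_of_mem _ (Subgroup.mem_top _), full_one_meet]
    have h2 : Nat.card (full (1 : G →* ℂˣ)).H = Fintype.card G := by
      rw [← Nat.card_eq_fintype_card]
      exact Subgroup.card_top
    rw [Finset.sum_congr rfl fun g _ => h1 g, Finset.sum_const, Finset.card_univ, ← h2] at h
    simp only [wsymb, map_nsmul, AddMonoidHom.nsmul_apply] at h
    rw [AddMonoidHom.id_apply, h, smul_comm]
  exact DFunLike.congr_fun this x

/-- The monomial ring `M(G)`. -/
instance : CommRing (MonomialRing G) where
  __ := (inferInstance : AddCommGroup (MonomialRing G))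
  mul x y := mulHom x y
  one := symb (full 1)
  mul_assoc := mulHom_assoc
  mul_comm := mulHom_comm
  one_mul := one_mulHom
  mul_one x := (mulHom_comm x _).trans (one_mulHom x)
  left_distrib x y z := map_add (mulHom x) y z
  right_distrib x y z := DFunLike.congr_fun (map_add mulHom x y) z
  zero_mul x := DFunLike.congr_fun (map_zero mulHom) x
  mul_zero x := map_zero (mulHom x)

theorem symb_mul_symb (p q : MonomialPair G) :
    symb p * symb q = ∑ᶠ d : DoubleCoset.Quotient (p.H : Set G) (q.H : Set G), term p q d :=
  mulHom_symb p q

theorem one_eq_symb : (1 : MonomialRing G) = symb (full 1) := rfl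

end Ring

section Functoriality

variable {G : Type u} [Group G]

/-- Induction `M(H) → M(G)` from a subgroup, `[K, ψ] ↦ [K, ψ]`. -/
def ind (H : Subgroup G) : MonomialRing H →ₗ[ℤ] MonomialRing G :=
  (lift (fun p => symb (p.ofSubgroup H))
    fun h p => by rw [ofSubgroup_smul, symb_smul]).toIntLinearMap

/-- Inflation `M(G/N) → M(G)`, sending `[K, ψ]` to `[π⁻¹(K), ψ ∘ π]` for `π : G → G/N` the
projection. -/
def infl (N : Subgroup G) [N.Normal] : MonomialRing (G ⧸ N) →ₗ[ℤ] MonomialRing G :=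
  (lift (fun p => symb (p.comap (QuotientGroup.mk' N))) fun g p => by
    obtain ⟨g, rfl⟩ := QuotientGroup.mk'_surjective N g
    rw [comap_smul, symb_smul]).toIntLinearMap

end Functoriality

end MonomialRing

/-- A finite-dimensional complex representation of `G`, equivalently a finitely generated
`ℂ[G]`-module. -/
structure FinRep (G : Type u) [Group G] where
  /-- the underlying space -/
  V : Type u
  [addCommGroup : AddCommGroup V]
  [module : Module ℂ V]
  [finite : Module.Finite ℂ V]
  /-- the action of the group -/
  ρ : Representation ℂ G V

namespace FinRep

attribute [instance] addCommGroup module finite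

variable (G : Type u) [Group G]

instance setoid : Setoid (FinRep G) where
  r V W := Nonempty (V.ρ.Equiv W.ρ)
  iseqv :=
    { refl := fun V => ⟨.refl V.ρ⟩
      symm := fun ⟨e⟩ => ⟨e.symm⟩
      trans := fun ⟨e⟩ ⟨e'⟩ => ⟨e.trans e'⟩ }

/-- Isomorphism classes of finite-dimensional complex representations. -/
def IsoClass : Type (u + 1) := Quotient (setoid G)

variable {G}

/-- The isomorphism class of a representation. -/
def isoClass (V : FinRep G) : IsoClass G := Quotient.mk _ V

/-- The direct sum of two representations. -/
def directSum (V W : FinRep G) : FinRep G where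
  V := V.V × W.V
  ρ := V.ρ.prod W.ρ

end FinRep

/-- The representation ring `R_ℂ(G)`, as an abelian group: the free abelian group on isomorphism
classes of finite-dimensional complex representations modulo the relations
`[V ⊕ W] - [V] - [W]`. -/
def RepRing (G : Type u) [Group G] : Type (u + 1) :=
  FreeAbelianGroup (FinRep.IsoClass G) ⧸ AddSubgroup.closure
    {x : FreeAbelianGroup (FinRep.IsoClass G) | ∃ V W : FinRep G,
      x = FreeAbelianGroup.of (V.directSum W).isoClass
        - FreeAbelianGroup.of V.isoClass - FreeAbelianGroup.of W.isoClass}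

namespace RepRing

variable {G : Type u} [Group G]

instance : AddCommGroup (RepRing G) := by
  unfold RepRing
  infer_instance

/-- The class of a representation in the representation ring. -/
def of (V : FinRep G) : RepRing G :=
  QuotientAddGroup.mk (FreeAbelianGroup.of V.isoClass)

theorem of_eq_of_equiv {V W : FinRep G} (e : V.ρ.Equiv W.ρ) : of V = of W := by
  have : V.isoClass = W.isoClass := Quotient.sound ⟨e⟩
  rw [of, of, this]

end RepRing

namespace MonomialPair

variable {G : Type u} [Group G]

/-- The one-dimensional representation of `H` on `ℂ` given by `χ : H → ℂˣ`. -/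
def rep (p : MonomialPair G) : Representation ℂ p.H ℂ where
  toFun h := (p.χ h : ℂ) • LinearMap.id
  map_one' := by ext; simp
  map_mul' g h := by ext; simp [mul_comm]

@[simp]
theorem rep_apply (p : MonomialPair G) (h : p.H) (z : ℂ) : p.rep h z = p.χ h * z := rfl

/-- The induced representation `Ind_H^G χ`. -/
def indRep [Finite G] (p : MonomialPair G) : FinRep G where
  V := Representation.IndV p.H.subtype p.rep
  ρ := Representation.ind p.H.subtype p.rep

/-- The map `Ind χ → Ind (g • χ)` sending `⟦x ⊗ z⟧` to `⟦g x ⊗ z⟧`. -/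
def conjMap (p q : MonomialPair G) (g : G) (hg : q = g • p) :
    Representation.IndV p.H.subtype p.rep →ₗ[ℂ] Representation.IndV q.H.subtype q.rep :=
  Representation.Coinvariants.lift _
    (Representation.Coinvariants.mk _ ∘ₗ
      (MonoidAlgebra.mapDomainLinearMap ℂ ℂ fun x => g * x).rTensor ℂ) (by
    subst hg
    intro h
    ext x
    have hm : g * (h * g⁻¹) ∈ (g • p).H := (mem_smul _ _ _).2 (by simp [mul_assoc])
    have hχ : (g • p).χ ⟨g * (h * g⁻¹), hm⟩ = p.χ h := by
      rw [smul_χ]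
      congr 1
      exact Subtype.ext (by dsimp only; group)
    have := (Representation.Coinvariants.mk_self_apply
      (Representation.tprod ((Representation.leftRegular ℂ G).comp (g • p).H.subtype) (g • p).rep)
      ⟨g * (h * g⁻¹), hm⟩ (TensorProduct.tmul ℂ (MonoidAlgebra.single (g * x) 1) 1))
    simpa [hχ, mul_assoc] using this)

theorem conjMap_mk (p q : MonomialPair G) (g : G) (hg : q = g • p) (x : G) (z : ℂ) :
    conjMap p q g hg (Representation.IndV.mk _ _ x z) = Representation.IndV.mk _ _ (g * x) z := by
  simp [conjMap]

theorem conjMap_comp (p q : MonomialPair G) (g g' : G) (hg : q = g • p) (hg' : p = g' • q)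
    (h1 : g' * g = 1) : conjMap q p g' hg' ∘ₗ conjMap p q g hg = LinearMap.id := by
  refine Representation.IndV.hom_ext _ _ fun x => LinearMap.ext fun z => ?_
  rw [LinearMap.comp_apply, LinearMap.comp_apply, conjMap_mk, conjMap_mk, ← mul_assoc, h1, one_mul]
  rfl

/-- Conjugate pairs have isomorphic induced representations. -/
def conjEquiv [Finite G] (p : MonomialPair G) (g : G) :
    p.indRep.ρ.Equiv (g • p).indRep.ρ :=
  .mk (LinearEquiv.ofLinearMap (conjMap p (g • p) g rfl) (conjMap (g • p) p g⁻¹ (by simp))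
    (conjMap_comp _ _ _ _ _ _ (mul_inv_cancel g)) (conjMap_comp _ _ _ _ _ _ (inv_mul_cancel g)))
    (by
      intro h
      refine Representation.IndV.hom_ext _ _ fun x => LinearMap.ext fun z => ?_
      change conjMap p (g • p) g rfl (Representation.ind p.H.subtype p.rep h
          (Representation.IndV.mk _ _ x z)) =
        Representation.ind (g • p).H.subtype (g • p).rep h
          (conjMap p (g • p) g rfl (Representation.IndV.mk _ _ x z))
      rw [Representation.ind_mk, conjMap_mk, conjMap_mk, Representation.ind_mk, mul_assoc])

end MonomialPair

namespace MonomialRing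

/-- The map `m : M(G) → R_ℂ(G)`, `[H, χ] ↦ Ind_H^G χ`. -/
def toRepRing (G : Type u) [Group G] [Finite G] : MonomialRing G →ₗ[ℤ] RepRing G :=
  (lift (fun p => RepRing.of p.indRep)
    fun g p => (RepRing.of_eq_of_equiv (conjEquiv p g)).symm).toIntLinearMap

/-- The group of monomial relations of `G`, i.e. the kernel of `M(G) → R_ℂ(G)`. -/
def relations (G : Type u) [Group G] [Finite G] : Submodule ℤ (MonomialRing G) :=
  LinearMap.ker (toRepRing G)

/-- The subalgebra `D(G)` of `M(G)` generated over `ℤ` by the symbols `[G, χ]`. -/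
def linearSubalgebra (G : Type u) [Group G] [Finite G] : Subalgebra ℤ (MonomialRing G) :=
  Algebra.adjoin ℤ (Set.range fun χ : G →* ℂˣ => symb (full χ))

/-- The `D(G)`-imprimitive monomial relations of `G`: the product with `D(G)` of the subgroup
generated by the relations induced from proper subgroups and the relations inflated from
quotients by non-trivial normal subgroups. -/
def imprimitive (G : Type u) [Group G] [Finite G] : Submodule ℤ (MonomialRing G) :=
  Subalgebra.toSubmodule (linearSubalgebra G) *
    ((⨆ (H : Subgroup G) (_ : H < ⊤), (relations H).map (ind H)) ⊔
      ⨆ (N : Subgroup G) (_ : N.Normal) (_ : N ≠ ⊥), (relations (G ⧸ N)).map (infl N))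

/-- The `D(G)`-primitive quotient of the group of monomial relations of `G`. -/
abbrev PrimitiveQuotient (G : Type u) [Group G] [Finite G] : Type u :=
  relations G ⧸ (imprimitive G).submoduleOf (relations G)

end MonomialRing

/-- A group is elementary if it is the direct product of a finite cyclic group and a finite
`p`-group for some prime `p`. -/
def IsElementaryGroup (Q : Type u) [Group Q] : Prop :=
  Finite Q ∧ ∃ p : ℕ, p.Prime ∧ ∃ C P : Subgroup Q,
    IsCyclic C ∧ IsPGroup p P ∧ Nonempty (Q ≃* C × P)

end

/-! Characters separate classes in `RepRing`, so an element of `M(G)` is a monomial relation exactly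
when its character `ch` vanishes (`mem_relations`). Since `ch` is multiplicative, `K(G)` is an
ideal.

The projection formula `x · [H, χ] = Ind (Res x · χ)` (`exists_ind_eq_mul`) shows that a relation
times a symbol of a proper subgroup is induced from a relation of that subgroup. The theorem thus
reduces to finding `y` in `M(G/N)`, a combination of symbols of proper subgroups, whose character is
`1`. Then `1 - y` is a relation of `G/N`, and every relation `x` of `G` equals `x · Inf (1 - y) + x
· Inf y`, where both terms are imprimitive (`relations_le_imprimitive`).

Such a `y` exists for every non-elementary finite group, a form of Brauer's induction theorem
(`exists_ch_eq_one`). If the group is `p`-hyperelementary for no prime `p`, permutation characters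
on cosets of proper subgroups suffice, by Banaschewski's criterion and a count of fixed points
modulo `p`. Otherwise the group is `C ⋊ P` with `C` cyclic of order prime to `p` and `P` a `p`-group
acting non-trivially. The permutation character on the cosets of `C^P ⋊ P` is then `1` plus
characters induced from stabilizers of non-trivial characters of `C` that are trivial on `C^P`.
Coprimality forces these stabilizers to be proper. -/

noncomputable section

open MonomialPair

/-! ### Virtual representations are determined by their characters -/

namespace RepRing

variable {G : Type u} [Group G]

theorem of_directSum (V W : FinRep G) : of (V.directSum W) = of V + of W := by
  have h : (QuotientAddGroup.mk (FreeAbelianGroup.of (V.directSum W).isoClass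
      - FreeAbelianGroup.of V.isoClass - FreeAbelianGroup.of W.isoClass) : RepRing G) = 0 :=
    (QuotientAddGroup.eq_zero_iff _).2 (AddSubgroup.subset_closure ⟨V, W, rfl⟩)
  have h' : of (V.directSum W) - of V - of W = 0 := h
  rw [sub_sub, sub_eq_zero] at h'
  exact h'

theorem induction_on {P : RepRing G → Prop} (x : RepRing G) (h0 : P 0)
    (hof : ∀ V, P (of V)) (hneg : ∀ V, P (of V) → P (-of V))
    (hadd : ∀ x y, P x → P y → P (x + y)) : P x := by
  obtain ⟨y, rfl⟩ := QuotientAddGroup.mk_surjective x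
  induction y using FreeAbelianGroup.induction_on with
  | zero => exact h0
  | of c => induction c using Quotient.inductionOn with | h V => exact hof V
  | neg c ih => induction c using Quotient.inductionOn with | h V => exact hneg V ih
  | add x y hx hy => exact hadd _ _ hx hy

/-- Every element of the representation ring is a difference of two representations. -/
theorem exists_eq_sub (x : RepRing G) : ∃ V W : FinRep G, x = of V - of W := by
  -- The zero representation `Z` satisfies `Z ⊕ Z ≅ Z`, so its class vanishes; it fills the missing
  -- side of a difference.
  have hz : of (⟨PUnit, 1⟩ : FinRep G) = 0 := by
    have e : ((⟨PUnit, 1⟩ : FinRep G).directSum ⟨PUnit, 1⟩).ρ.Equiv (⟨PUnit, 1⟩ : FinRep G).ρ :=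
      .mk (LinearEquiv.ofLinearMap (LinearMap.fst ℂ PUnit.{u+1} PUnit.{u+1})
        (LinearMap.inl ℂ PUnit.{u+1} PUnit.{u+1})
        (by ext) (LinearMap.ext fun _ => rfl)) fun g => LinearMap.ext fun _ => rfl
    simpa [of_directSum] using of_eq_of_equiv e
  induction x using induction_on with
  | h0 => exact ⟨⟨PUnit, 1⟩, ⟨PUnit, 1⟩, by simp⟩
  | hof V => exact ⟨V, ⟨PUnit, 1⟩, by rw [hz, sub_zero]⟩
  | hneg V _ => exact ⟨⟨PUnit, 1⟩, V, by rw [hz, zero_sub]⟩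
  | hadd x y hx hy =>
    obtain ⟨V, W, rfl⟩ := hx
    obtain ⟨V', W', rfl⟩ := hy
    exact ⟨V.directSum V', W.directSum W', by rw [of_directSum, of_directSum]; abel⟩

theorem character_directSum (V W : FinRep G) :
    (V.directSum W).ρ.character = V.ρ.character + W.ρ.character := by
  ext g
  exact LinearMap.trace_prodMap' (V.ρ g) (W.ρ g)

/-- The character of a formal combination of isomorphism classes of representations. -/
def formalCharacter : FreeAbelianGroup (FinRep.IsoClass G) →+ (G → ℂ) :=
  FreeAbelianGroup.lift (Quotient.lift (fun V : FinRep G => V.ρ.character)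
    fun _ _ ⟨e⟩ => Representation.char_iso e)

theorem formalCharacter_of (V : FinRep G) :
    formalCharacter (FreeAbelianGroup.of V.isoClass) = V.ρ.character :=
  FreeAbelianGroup.lift_apply_of _ _

/-- The character of a virtual representation. -/
def character : RepRing G →+ (G → ℂ) :=
  QuotientAddGroup.lift _ formalCharacter (by
    rw [AddSubgroup.closure_le]
    rintro _ ⟨V, W, rfl⟩
    simp only [SetLike.mem_coe, AddMonoidHom.mem_ker, map_sub, formalCharacter_of,
      character_directSum]
    abel)

@[simp]
theorem character_of (V : FinRep G) : character (of V) = V.ρ.character :=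
  formalCharacter_of V

/-- A subrepresentation as a representation in its own right. -/
abbrev _root_.FinRep.sub (V : FinRep G) (S : Subrepresentation V.ρ) : FinRep G where
  V := S.toSubmodule
  ρ := S.toRepresentation

theorem of_eq_add_of_isCompl (V : FinRep G) {S T : Subrepresentation V.ρ} (h : IsCompl S T) :
    of V = of (V.sub S) + of (V.sub T) := by
  have h' : IsCompl S.toSubmodule T.toSubmodule := by
    constructor
    · rw [disjoint_iff]
      exact congrArg Subrepresentation.toSubmodule h.inf_eq_bot
    · rw [codisjoint_iff]
      exact congrArg Subrepresentation.toSubmodule h.sup_eq_top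
  rw [← of_directSum]
  symm
  refine of_eq_of_equiv (.mk (Submodule.prodEquivOfIsCompl _ _ h') fun g => ?_)
  refine LinearMap.ext fun x => ?_
  change V.ρ g x.1 + V.ρ g x.2 = V.ρ g (x.1 + x.2)
  rw [map_add]

variable [Finite G]

instance : NeZero (Nat.card G : ℂ) := ⟨Nat.cast_ne_zero.2 (Nat.pos_iff_ne_zero.1 Nat.card_pos)⟩

/-- Finite-dimensional complex representations with the same character have the same class. -/
theorem of_eq_of_character_eq (V W : FinRep G) (h : V.ρ.character = W.ρ.character) :
    of V = of W := by
  let _ : Fintype G := Fintype.ofFinite G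
  let _ : Invertible (Nat.card G : ℂ) := invertibleOfNonzero (NeZero.ne _)
  -- Induction on the dimension. A non-zero intertwiner `f : V → W` gives `V = ker f ⊕ T` and `W =
  -- range f ⊕ U` with `T ≅ range f`; so `ker f` and `U` have equal characters, and `ker f` has
  -- smaller dimension than `V`.
  induction hn : Module.finrank ℂ V.V using Nat.strong_induction_on generalizing V W with
  | _ n ih =>
    subst hn
    have hdim : Module.finrank ℂ V.V = Module.finrank ℂ W.V := by
      have h1 := congrFun h 1
      rw [Representation.char_one, Representation.char_one] at h1
      exact_mod_cast h1
    rcases Nat.eq_zero_or_pos (Module.finrank ℂ V.V) with h0 | hpos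
    · have e : V.V ≃ₗ[ℂ] W.V := LinearEquiv.ofFinrankEq _ _ hdim
      have : Subsingleton W.V := Module.finrank_zero_iff.1 (hdim ▸ h0)
      exact of_eq_of_equiv (.mk e fun g => LinearMap.ext fun x => Subsingleton.elim _ _)
    -- By orthogonality `dim Hom(V, W)` depends only on the characters, so it equals `dim Hom(V,
    -- V)`, which is non-zero because of the identity.
    · obtain ⟨f, hf⟩ : ∃ f : Representation.IntertwiningMap V.ρ W.ρ, f ≠ 0 := by
        have h1 := Representation.card_inv_mul_sum_char_mul_char_eq_finrank V.ρ V.ρ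
        have h2 := Representation.card_inv_mul_sum_char_mul_char_eq_finrank V.ρ W.ρ
        rw [← h, h1] at h2
        have h3 : Module.finrank ℂ (Representation.IntertwiningMap V.ρ V.ρ) ≠ 0 := by
          intro h4
          have : Subsingleton (Representation.IntertwiningMap V.ρ V.ρ) :=
            Module.finrank_zero_iff.1 h4
          have : Nontrivial V.V := Module.finrank_pos_iff.1 hpos
          obtain ⟨v, hv⟩ := exists_ne (0 : V.V)
          exact hv (congrArg (fun k : Representation.IntertwiningMap V.ρ V.ρ => k v)
            (Subsingleton.elim (Representation.IntertwiningMap.id V.ρ) 0))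
        by_contra! hc
        apply h3
        have : Subsingleton (Representation.IntertwiningMap V.ρ W.ρ) :=
          ⟨fun a b => (hc a).trans (hc b).symm⟩
        have h5 := Module.finrank_zero_of_subsingleton (R := ℂ)
          (M := Representation.IntertwiningMap V.ρ W.ρ)
        rw [h5] at h2
        exact_mod_cast h2
      obtain ⟨T, hT⟩ := ComplementedLattice.exists_isCompl f.ker
      obtain ⟨U, hU⟩ := ComplementedLattice.exists_isCompl f.range
      have hTR : of (V.sub T) = of (W.sub f.range) := by
        have hdisj : Disjoint (LinearMap.ker f.toLinearMap) T.toSubmodule := by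
          rw [disjoint_iff]
          exact congrArg Subrepresentation.toSubmodule hT.inf_eq_bot
        have hcod : LinearMap.ker f.toLinearMap ⊔ T.toSubmodule = ⊤ :=
          congrArg Subrepresentation.toSubmodule hT.sup_eq_top
        let k : T.toSubmodule →ₗ[ℂ] f.range.toSubmodule :=
          (f.toLinearMap.comp T.toSubmodule.subtype).codRestrict _ fun x => ⟨x, rfl⟩
        refine of_eq_of_equiv (.mk (LinearEquiv.ofBijective k ⟨?_, ?_⟩) fun g => ?_)
        · rw [← LinearMap.ker_eq_bot, LinearMap.ker_eq_bot']
          intro x hx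
          have hx' : f.toLinearMap x = 0 := congrArg Subtype.val hx
          exact Subtype.ext (Submodule.disjoint_def.1 hdisj x hx' x.2)
        · rintro ⟨_, v, rfl⟩
          obtain ⟨a, ha, b, hb, rfl⟩ := Submodule.mem_sup.1 (hcod ▸ Submodule.mem_top (x := v))
          refine ⟨⟨b, hb⟩, Subtype.ext ?_⟩
          change f.toLinearMap b = f.toLinearMap (a + b)
          rw [map_add, LinearMap.mem_ker.1 ha, zero_add]
        · refine LinearMap.ext fun x => Subtype.ext ?_
          exact f.isIntertwining _ _ g x
      have hV := of_eq_add_of_isCompl V hT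
      have hW := of_eq_add_of_isCompl W hU
      have hchar : (V.sub f.ker).ρ.character = (W.sub U).ρ.character := by
        have h1 := congrArg character hV
        have h2 := congrArg character hW
        have h3 := congrArg character hTR
        simp only [map_add, character_of] at h1 h2 h3
        rw [h, h2, h3, add_comm] at h1
        exact (add_right_cancel h1).symm
      have hlt : Module.finrank ℂ (V.sub f.ker).V < Module.finrank ℂ V.V := by
        apply Submodule.finrank_lt
        intro htop
        apply hf
        ext v
        have : v ∈ f.ker.toSubmodule := htop ▸ Submodule.mem_top
        exact this
      rw [hV, hW, ih _ hlt _ _ hchar rfl, hTR, add_comm]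

theorem character_injective : Function.Injective (character : RepRing G →+ (G → ℂ)) := by
  rw [injective_iff_map_eq_zero]
  intro x hx
  obtain ⟨V, W, rfl⟩ := exists_eq_sub x
  rw [map_sub, character_of, character_of, sub_eq_zero] at hx
  rw [of_eq_of_character_eq V W hx, sub_self]

end RepRing

/-! ### The character formula for induced representations -/

namespace MonomialPair

variable {G : Type u} [Group G]

open scoped Classical in
/-- The function `χ` of a pair `(H, χ)`, extended by zero outside `H`. -/
def ev (p : MonomialPair G) (g : G) : ℂ := if h : g ∈ p.H then (p.χ ⟨g, h⟩ : ℂ) else 0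

theorem ev_of_mem (p : MonomialPair G) {g : G} (h : g ∈ p.H) : p.ev g = (p.χ ⟨g, h⟩ : ℂ) :=
  dif_pos h

theorem ev_of_notMem (p : MonomialPair G) {g : G} (h : g ∉ p.H) : p.ev g = 0 :=
  dif_neg h

theorem ev_comap {G' : Type u} [Group G'] (f : G' →* G) (p : MonomialPair G) (g : G') :
    (p.comap f).ev g = p.ev (f g) := rfl

theorem ev_smul (t : G) (p : MonomialPair G) (g : G) : (t • p).ev g = p.ev (t⁻¹ * g * t) := by
  change (p.comap _).ev g = _
  rw [ev_comap]
  simp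

theorem ev_meet (p q : MonomialPair G) (g : G) : (p.meet q).ev g = p.ev g * q.ev g := by
  by_cases hp : g ∈ p.H
  · by_cases hq : g ∈ q.H
    · have h : g ∈ (p.meet q).H := ⟨hp, hq⟩
      rw [ev_of_mem p hp, ev_of_mem q hq, ev_of_mem _ h, meet_χ, Units.val_mul]
    · rw [ev_of_notMem q hq, mul_zero, ev_of_notMem _ fun h => hq ((mem_meet _ _ _).1 h).2]
  · rw [ev_of_notMem p hp, zero_mul, ev_of_notMem _ fun h => hp ((mem_meet _ _ _).1 h).1]

theorem ev_full (χ : G →* ℂˣ) (g : G) : (full χ).ev g = χ g :=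
  ev_of_mem _ (Subgroup.mem_top g)

theorem ev_ofSubgroup_of_mem (H : Subgroup G) (p : MonomialPair H) (h : H) :
    (p.ofSubgroup H).ev h = p.ev h := by
  by_cases hp : h ∈ p.H
  · have : (h : G) ∈ (p.ofSubgroup H).H := (mem_ofSubgroup _ _ _).2 ⟨h.2, hp⟩
    rw [ev_of_mem _ hp, ev_of_mem _ this, ofSubgroup_χ H p h hp]
  · rw [ev_of_notMem _ hp, ev_of_notMem]
    rw [mem_ofSubgroup]
    exact fun ⟨_, h'⟩ => hp h'

theorem ev_ofSubgroup_of_notMem (H : Subgroup G) (p : MonomialPair H) {g : G} (h : g ∉ H) :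
    (p.ofSubgroup H).ev g = 0 :=
  ev_of_notMem _ fun h' => h ((mem_ofSubgroup _ _ _).1 h').1

end MonomialPair

/-- Cyclicity of the trace moves the computation from a quotient `W` of `V` up to `V`, at the cost
of the idempotent `s ∘ π`. It serves for spaces of coinvariants. -/
theorem LinearMap.trace_of_comp_eq {K V W : Type*} [Field K] [AddCommGroup V] [Module K V]
    [AddCommGroup W] [Module K W] [FiniteDimensional K V] [FiniteDimensional K W]
    (π : V →ₗ[K] W) (s : W →ₗ[K] V) (hs : π ∘ₗ s = LinearMap.id) (T : V →ₗ[K] V)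
    (T' : W →ₗ[K] W) (hT : T' ∘ₗ π = π ∘ₗ T) :
    LinearMap.trace K W T' = LinearMap.trace K V (T ∘ₗ s ∘ₗ π) := by
  rw [← LinearMap.comp_assoc, LinearMap.trace_comp_comm', ← LinearMap.comp_assoc, ← hT,
    LinearMap.comp_assoc, hs, LinearMap.comp_id]

open scoped Classical in
theorem MonoidAlgebra.trace_mapDomain {G : Type*} [Fintype G] (σ : G → G) :
    LinearMap.trace ℂ _ (MonoidAlgebra.mapDomainLinearMap ℂ ℂ σ) =
      ∑ x : G, if σ x = x then 1 else 0 := by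
  let b : Module.Basis G ℂ (MonoidAlgebra ℂ G) := .ofRepr (MonoidAlgebra.coeffLinearEquiv ℂ)
  rw [LinearMap.trace_eq_matrix_trace ℂ b, Matrix.trace]
  refine Finset.sum_congr rfl fun x _ => ?_
  rw [Matrix.diag_apply, LinearMap.toMatrix_apply]
  have hb : ∀ y, b y = MonoidAlgebra.single y 1 := fun y => rfl
  rw [hb, show MonoidAlgebra.mapDomainLinearMap ℂ ℂ σ (MonoidAlgebra.single x 1) = b (σ x) by
    simp [hb], b.repr_self, Finsupp.single_apply]

namespace MonomialPair

variable {G : Type u} [Group G]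

/-- The induced space is the space of `H`-coinvariants of `ℂ[G] ⊗ ℂ`, and averaging over `H` gives a
section of the projection. The trace of `g` is therefore the average over `h` in `H` of traces on
`ℂ[G] ⊗ ℂ`. -/
theorem character_indRep [Fintype G] (p : MonomialPair G) (g : G) :
    p.indRep.ρ.character g = (Nat.card p.H : ℂ)⁻¹ * ∑ t : G, p.ev (t * g * t⁻¹) := by
  classical
  let _ : Fintype p.H := Fintype.ofFinite _
  have hH : (Fintype.card p.H : ℂ) ≠ 0 := Nat.cast_ne_zero.2 Fintype.card_ne_zero
  let τ := Representation.tprod ((Representation.leftRegular ℂ G).comp p.H.subtype) p.rep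
  let π := Representation.Coinvariants.mk τ
  let e := (Fintype.card p.H : ℂ)⁻¹ • ∑ h : p.H, τ h
  have he : ∀ h, e ∘ₗ τ h = e := by
    intro h
    change e * τ h = e
    rw [smul_mul_assoc, Finset.sum_mul]
    congr 1
    refine Fintype.sum_equiv (Equiv.mulRight h) _ _ fun k => ?_
    rw [← map_mul]
    rfl
  let s := Representation.Coinvariants.lift τ e he
  have hs : π ∘ₗ s = LinearMap.id := by
    refine Representation.Coinvariants.hom_ext (LinearMap.ext fun x => ?_)
    change π (e x) = π x
    have : ∀ h, π (τ h x) = π x := fun h => Representation.Coinvariants.mk_self_apply τ h x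
    simp only [e, LinearMap.smul_apply, LinearMap.sum_apply, map_smul, map_sum, this,
      Finset.sum_const, Finset.card_univ]
    rw [← Nat.cast_smul_eq_nsmul ℂ, smul_smul, inv_mul_cancel₀ hH, one_smul]
  have hT := LinearMap.trace_of_comp_eq π s hs
    ((MonoidAlgebra.mapDomainLinearMap ℂ ℂ fun x => x * g⁻¹).rTensor ℂ) (p.indRep.ρ g) rfl
  rw [Representation.character]
  refine hT.trans ?_
  have hsπ : s ∘ₗ π = e := rfl
  rw [hsπ, Nat.card_eq_fintype_card]
  have hlin : ((MonoidAlgebra.mapDomainLinearMap ℂ ℂ fun x : G => x * g⁻¹).rTensor ℂ) ∘ₗ e =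
      (Fintype.card p.H : ℂ)⁻¹ • ∑ h : p.H,
        ((MonoidAlgebra.mapDomainLinearMap ℂ ℂ fun x : G => x * g⁻¹).rTensor ℂ) ∘ₗ τ h := by
    rw [LinearMap.comp_smul]
    congr 1
    refine LinearMap.ext fun x => ?_
    simp only [LinearMap.comp_apply, LinearMap.sum_apply, map_sum]
  rw [hlin, map_smul, map_sum, smul_eq_mul]
  congr 1
  -- The composite permutes the basis of `ℂ[G]` by `x ↦ h x g⁻¹` and scales by `χ h`. A fixed point
  -- `x` is one with `h = x g x⁻¹`.
  have hone : ∀ h : p.H, LinearMap.trace ℂ _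
      (((MonoidAlgebra.mapDomainLinearMap ℂ ℂ fun x : G => x * g⁻¹).rTensor ℂ) ∘ₗ τ h) =
      ∑ x : G, if (h : G) = x * g * x⁻¹ then (p.χ h : ℂ) else 0 := by
    intro h
    have h1 : ((MonoidAlgebra.mapDomainLinearMap ℂ ℂ fun x : G => x * g⁻¹).rTensor ℂ) ∘ₗ τ h =
        TensorProduct.map (MonoidAlgebra.mapDomainLinearMap ℂ ℂ fun x : G => h * x * g⁻¹)
          (p.rep h) := by
      ext x
      simp [τ]
    rw [h1, LinearMap.trace_tensorProduct', MonoidAlgebra.trace_mapDomain]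
    have h2 : LinearMap.trace ℂ ℂ (p.rep h) = (p.χ h : ℂ) := by
      change LinearMap.trace ℂ ℂ ((p.χ h : ℂ) • LinearMap.id) = _
      simp
    rw [h2, Finset.sum_mul]
    refine Finset.sum_congr rfl fun x _ => ?_
    have : (h : G) * x * g⁻¹ = x ↔ (h : G) = x * g * x⁻¹ := by
      rw [mul_inv_eq_iff_eq_mul, eq_mul_inv_iff_mul_eq]
    simp only [this, ite_mul, one_mul, zero_mul]
  simp only [hone]
  rw [Finset.sum_comm]
  refine Finset.sum_congr rfl fun x _ => ?_
  by_cases hx : x * g * x⁻¹ ∈ p.H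
  · rw [ev_of_mem p hx, Finset.sum_eq_single ⟨_, hx⟩]
    · rw [if_pos rfl]
    · intro h _ hne
      rw [if_neg fun h' => hne (Subtype.ext h')]
    · simp
  · rw [ev_of_notMem p hx]
    exact Finset.sum_eq_zero fun h _ => if_neg fun h' => hx (by
      rw [← h']
      exact h.2)

end MonomialPair

/-! ### The character as a ring homomorphism on the monomial ring -/

namespace MonomialRing

variable {G : Type u} [Group G]

theorem ind_symb (H : Subgroup G) (p : MonomialPair H) :
    ind H (symb p) = symb (p.ofSubgroup H) :=
  lift_symb _ (fun h p => by rw [ofSubgroup_smul, symb_smul]) p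

theorem card_ofSubgroup (H : Subgroup G) (p : MonomialPair H) :
    Nat.card (p.ofSubgroup H).H = Nat.card p.H :=
  (Nat.card_congr (p.H.equivMapOfInjective H.subtype H.subtype_injective).toEquiv).symm

variable [Finite G]

/-- The character of the virtual representation attached to an element of `M(G)`. -/
def ch : MonomialRing G →+ (G → ℂ) := RepRing.character.comp (toRepRing G).toAddMonoidHom

theorem ch_symb [Fintype G] (p : MonomialPair G) (g : G) :
    ch (symb p) g = (Nat.card p.H : ℂ)⁻¹ * ∑ t : G, p.ev (t * g * t⁻¹) := by
  have : toRepRing G (symb p) = RepRing.of p.indRep :=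
    lift_symb _ (fun g p => (RepRing.of_eq_of_equiv (conjEquiv p g)).symm) p
  change RepRing.character (toRepRing G (symb p)) g = _
  rw [this, RepRing.character_of, character_indRep]

/-- Injectivity of the character on `RepRing` makes being a relation an identity between functions
on `G`; all later arguments take place there. -/
theorem mem_relations {x : MonomialRing G} : x ∈ relations G ↔ ch x = 0 := by
  rw [relations, LinearMap.mem_ker]
  exact (map_eq_zero_iff _ RepRing.character_injective).symm

theorem card_cast_ne_zero (H : Subgroup G) : (Nat.card H : ℂ) ≠ 0 :=
  Nat.cast_ne_zero.2 Nat.card_pos.ne'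

theorem ch_wsymb [Fintype G] (p : MonomialPair G) (g : G) :
    ch (wsymb p) g = ∑ t : G, p.ev (t * g * t⁻¹) := by
  rw [wsymb, map_nsmul, Pi.smul_apply, ch_symb, nsmul_eq_mul,
    mul_inv_cancel_left₀ (card_cast_ne_zero _)]

@[elab_as_elim]
theorem symb_induction {P : MonomialRing G → Prop} (x : MonomialRing G) (h0 : P 0)
    (hof : ∀ p, P (symb p)) (hneg : ∀ x, P x → P (-x))
    (hadd : ∀ x y, P x → P y → P (x + y)) : P x := by
  refine FreeAbelianGroup.induction_on (motive := P) x h0 ?_ ?_ hadd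
  · intro c
    induction c using Quotient.inductionOn with | h p => exact hof p
  · intro c hc
    exact hneg _ hc

/-- For the weighted symbols `|H| [H, χ]` the double coset product is a sum over all of `G`. Its
character is a double sum that factors; the weights are then cancelled. -/
theorem ch_mul (x y : MonomialRing G) : ch (x * y) = ch x * ch y := by
  let _ : Fintype G := Fintype.ofFinite G
  have key : ∀ p q : MonomialPair G, ch (symb p * symb q) = ch (symb p) * ch (symb q) := by
    intro p q
    have h : ch (wsymb p * wsymb q) = ch (wsymb p) * ch (wsymb q) := by
      ext g
      have h1 : wsymb p * wsymb q = ∑ g : G, wsymb ((g⁻¹ • p).meet q) := mulHom_wsymb p q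
      rw [h1, map_sum, Finset.sum_apply, Pi.mul_apply, ch_wsymb, ch_wsymb, Finset.sum_mul_sum]
      simp only [ch_wsymb, ev_meet, ev_smul]
      rw [Finset.sum_comm]
      rw [Finset.sum_comm (f := fun i j => p.ev (i * g * i⁻¹) * q.ev (j * g * j⁻¹))]
      refine Finset.sum_congr rfl fun t _ => ?_
      -- Replacing `s` by `s t` decouples the conjugations applied to `p` and to `q`.
      refine Fintype.sum_equiv (Equiv.mulRight t) _ _ fun s => ?_
      congr 2
      simp only [Equiv.coe_mulRight]
      group
    simp only [wsymb, map_nsmul, smul_mul_assoc, mul_smul_comm] at h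
    rw [smul_right_inj (card_ne_zero q)] at h
    exact (smul_right_inj (card_ne_zero p)).1 h
  have h2 : ∀ (p) (y : MonomialRing G), ch (symb p * y) = ch (symb p) * ch y := by
    intro p y
    induction y using symb_induction with
    | h0 => simp
    | hof q => exact key p q
    | hneg x hx => rw [mul_neg, map_neg, map_neg, hx, mul_neg]
    | hadd x y hx hy => rw [mul_add, map_add, map_add, hx, hy, mul_add]
  induction x using symb_induction with
  | h0 => simp
  | hof p => exact h2 p y
  | hneg x hx => rw [neg_mul, map_neg, map_neg, hx, neg_mul]
  | hadd x y hx hy => rw [add_mul, map_add, map_add, hx, hy, add_mul]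

theorem ch_full (χ : G →* ℂˣ) : ch (symb (full χ)) = fun g => (χ g : ℂ) := by
  let _ : Fintype G := Fintype.ofFinite G
  ext g
  have h : ∀ t : G, (full χ).ev (t * g * t⁻¹) = χ g := fun t => by
    rw [ev_full]
    simp
  have hc : Nat.card (full χ).H = Fintype.card G := by
    rw [← Nat.card_eq_fintype_card]
    exact Subgroup.card_top
  simp only [ch_symb, h, Finset.sum_const, Finset.card_univ, nsmul_eq_mul]
  rw [hc, inv_mul_cancel_left₀ (Nat.cast_ne_zero.2 Fintype.card_ne_zero)]

theorem ch_one : ch (1 : MonomialRing G) = 1 := by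
  rw [one_eq_symb, ch_full]
  ext g
  simp

open scoped Classical in
/-- The character formula for induction from a subgroup. -/
theorem ch_ind [Fintype G] (H : Subgroup G) (x : MonomialRing H) (g : G) :
    ch (ind H x) g = (Nat.card H : ℂ)⁻¹ *
      ∑ t : G, if h : t * g * t⁻¹ ∈ H then ch x ⟨_, h⟩ else 0 := by
  let _ : Fintype H := Fintype.ofFinite H
  induction x using symb_induction with
  | h0 => simp
  | hof p =>
    have h1 : ∀ t : G, (if h : t * g * t⁻¹ ∈ H then ch (symb p) ⟨_, h⟩ else 0) =
        (Nat.card p.H : ℂ)⁻¹ * ∑ s : H, (p.ofSubgroup H).ev (s * (t * g * t⁻¹) * s⁻¹) := by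
      intro t
      split_ifs with h
      · rw [ch_symb]
        congr 1
        refine Finset.sum_congr rfl fun s _ => ?_
        rw [← ev_ofSubgroup_of_mem]
        rfl
      · symm
        apply mul_eq_zero_of_right
        refine Finset.sum_eq_zero fun s _ => ev_ofSubgroup_of_notMem _ _ fun h' => h ?_
        rwa [H.mul_mem_cancel_right (s⁻¹).2, H.mul_mem_cancel_left s.2] at h'
    simp only [h1]
    rw [ind_symb, ch_symb, card_ofSubgroup, ← Finset.mul_sum, Finset.sum_comm]
    have h2 : ∀ s : H, ∑ t : G, (p.ofSubgroup H).ev (s * (t * g * t⁻¹) * s⁻¹) =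
        ∑ t : G, (p.ofSubgroup H).ev (t * g * t⁻¹) := fun s => by
      refine Fintype.sum_equiv (Equiv.mulLeft (s : G)) _ _ fun t => ?_
      simp [mul_assoc]
    simp only [h2, Finset.sum_const, Finset.card_univ, nsmul_eq_mul, ← Nat.card_eq_fintype_card]
    field_simp [card_cast_ne_zero H]
  | hneg x hx =>
    rw [map_neg, map_neg, map_neg, Pi.neg_apply, hx, ← mul_neg, ← Finset.sum_neg_distrib]
    congr 1
    refine Finset.sum_congr rfl fun t _ => ?_
    split_ifs <;> simp
  | hadd x y hx hy =>
    rw [map_add, map_add, map_add, Pi.add_apply, hx, hy, ← mul_add, ← Finset.sum_add_distrib]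
    congr 1
    refine Finset.sum_congr rfl fun t _ => ?_
    split_ifs <;> simp

/-- The character of a pull-back along a surjective homomorphism. -/
theorem ch_symb_comap {Q : Type u} [Group Q] [Finite Q] (f : G →* Q) (hf : Function.Surjective f)
    (p : MonomialPair Q) (g : G) : ch (symb (p.comap f)) g = ch (symb p) (f g) := by
  classical
  let _ : Fintype G := Fintype.ofFinite G
  let _ : Fintype Q := Fintype.ofFinite Q
  have hfib : ∀ q : Q, (Finset.univ.filter fun t => f t = q).card = Nat.card f.ker := by
    intro q
    obtain ⟨a, rfl⟩ := hf q
    rw [Nat.card_eq_fintype_card, ← Fintype.card_subtype]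
    refine Fintype.card_congr ⟨fun t => ⟨a⁻¹ * t, ?_⟩, fun t => ⟨a * t, ?_⟩, ?_, ?_⟩
    · rw [MonoidHom.mem_ker, map_mul, t.2, map_inv, inv_mul_cancel]
    · rw [map_mul, t.2, mul_one]
    · intro t
      simp
    · intro t
      simp
  -- Pull-back along a surjection preserves the index, so the order grows by `|ker f|`, the size of
  -- each fibre of `f`. The two factors cancel in the character formula.
  have hcard : Nat.card (p.comap f).H = Nat.card f.ker * Nat.card p.H := by
    have h1 := (p.H.comap f).card_mul_index
    rw [Subgroup.index_comap_of_surjective p.H hf, ← f.ker.card_mul_index, Subgroup.index_ker,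
      MonoidHom.range_eq_top.2 hf, Subgroup.card_top, ← p.H.card_mul_index, ← mul_assoc] at h1
    exact mul_right_cancel₀ p.H.index_ne_zero_of_finite h1
  have hsum : ∑ t : G, p.ev (f t * f g * (f t)⁻¹) =
      Nat.card f.ker * ∑ q : Q, p.ev (q * f g * q⁻¹) := by
    rw [← Finset.sum_fiberwise Finset.univ f, Finset.mul_sum]
    refine Finset.sum_congr rfl fun q _ => ?_
    rw [Finset.sum_congr rfl (g := fun _ => p.ev (q * f g * q⁻¹))
      (fun t ht => by rw [(Finset.mem_filter.1 ht).2]), Finset.sum_const, hfib, nsmul_eq_mul]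
  rw [ch_symb, ch_symb, hcard]
  simp only [ev_comap, map_mul, map_inv, hsum]
  have := card_cast_ne_zero f.ker
  push_cast
  field_simp

end MonomialRing

/-! ### The projection formula and the reduction to a statement about `G/N` -/

namespace MonomialPair

variable {G : Type u} [Group G]

/-- The pair `(K ∩ H, Res ψ · Res χ)` of `H`, for pairs `(K, ψ)` and `p = (H, χ)` of `G`. -/
def restrict (p q : MonomialPair G) : MonomialPair p.H := (q.comap p.H.subtype).meet (full p.χ)

theorem ev_restrict (p q : MonomialPair G) (h : p.H) :
    (p.restrict q).ev h = q.ev h * p.χ h := by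
  rw [restrict, ev_meet, ev_comap, ev_full]
  rfl

theorem ofSubgroup_restrict (p q : MonomialPair G) :
    (p.restrict q).ofSubgroup p.H = q.meet p := by
  have hm : ∀ x : p.H, x ∈ (p.restrict q).H ↔ (x : G) ∈ q.H := fun x => by
    change _ ∧ x ∈ (⊤ : Subgroup p.H) ↔ _
    exact and_iff_left (Subgroup.mem_top _)
  refine ext' (fun x => ?_) (fun x hp hq => ?_)
  · rw [mem_ofSubgroup, mem_meet]
    exact ⟨fun ⟨h, h'⟩ => ⟨(hm _).1 h', h⟩, fun ⟨h, h'⟩ => ⟨h', (hm ⟨x, h'⟩).2 h⟩⟩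
  · obtain ⟨h, h'⟩ := (mem_ofSubgroup _ _ _).1 hp
    rw [ofSubgroup_χ p.H _ ⟨x, h⟩ h', meet_χ]
    rfl

theorem card_restrict (p q : MonomialPair G) :
    Nat.card (p.restrict q).H = Nat.card (q.meet p).H := by
  rw [← ofSubgroup_restrict, MonomialRing.card_ofSubgroup]

end MonomialPair

namespace MonomialRing

variable {G : Type u} [Group G]

theorem infl_symb (N : Subgroup G) [N.Normal] (p : MonomialPair (G ⧸ N)) :
    infl N (symb p) = symb (p.comap (QuotientGroup.mk' N)) :=
  lift_symb _ (fun g p => by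
    obtain ⟨g, rfl⟩ := QuotientGroup.mk'_surjective N g
    rw [comap_smul, symb_smul]) p

theorem comap_ne_top {Q : Type u} [Group Q] {f : G →* Q} (hf : Function.Surjective f)
    {p : MonomialPair Q} (hp : p.H ≠ ⊤) : (p.comap f).H ≠ ⊤ := by
  intro h
  apply hp
  rw [← Subgroup.comap_top f] at h
  exact Subgroup.comap_injective hf h

variable [Finite G]

/-- The projection formula `x · Ind χ = Ind (Res x · χ)` for symbols. -/
theorem exists_ind_eq_symb_mul (q p : MonomialPair G) :
    ∃ z : MonomialRing p.H, ind p.H z = symb q * symb p ∧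
      ∀ h : p.H, ch z h = ch (symb q) h * p.χ h := by
  classical
  let _ : Fintype G := Fintype.ofFinite G
  let _ : Fintype p.H := Fintype.ofFinite p.H
  let _ : Fintype (DoubleCoset.Quotient (q.H : Set G) (p.H : Set G)) := Fintype.ofFinite _
  -- Mackey's formula for `Res (Ind q)`, twisted by `χ`: one restricted conjugate of `q` for each
  -- double coset.
  refine ⟨∑ d : DoubleCoset.Quotient (q.H : Set G) (p.H : Set G),
    symb (p.restrict (d.out⁻¹ • q)), ?_, fun h => ?_⟩
  · rw [symb_mul_symb, finsum_eq_sum_of_fintype, map_sum]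
    refine Finset.sum_congr rfl fun d _ => ?_
    rw [ind_symb, ofSubgroup_restrict, ← term_mk]
    congr 1
    exact DoubleCoset.out_eq' _ _ d
  -- `S` is constant on double cosets. After multiplication by both subgroup orders, the summand of
  -- `d` becomes the sum of `S` over the elements of `d`, times `χ h`, so the total is a sum over
  -- `G`.
  · let F : G → ℂ := fun g => q.ev (g * h * g⁻¹)
    let S : G → ℂ := fun g => ∑ t : p.H, F (g * t)
    have hFl : ∀ k ∈ q.H, ∀ g, F (k * g) = F g := by
      intro k hk g
      have h1 := ev_smul k⁻¹ q (g * h * g⁻¹)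
      rw [smul_self_of_mem q (q.H.inv_mem hk)] at h1
      simp only [F]
      rw [h1]
      congr 1
      group
    have hS : ∀ g g' : G, DoubleCoset.mk q.H p.H g = DoubleCoset.mk q.H p.H g' → S g = S g' := by
      intro g g' hg
      obtain ⟨k, hk, t, ht, rfl⟩ := (DoubleCoset.eq _ _ _ _).1 hg
      simp only [S]
      refine Fintype.sum_equiv (Equiv.mulLeft (⟨t, ht⟩⁻¹ : p.H)) _ _ fun s => ?_
      have : k * g * t * (((⟨t, ht⟩⁻¹ : p.H) * s : p.H) : G) = k * (g * s) := by
        simp [mul_assoc]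
      rw [Equiv.coe_mulLeft, this, hFl k hk]
    have hterm : ∀ d : DoubleCoset.Quotient (q.H : Set G) (p.H : Set G),
        (Nat.card q.H * Nat.card p.H : ℂ) * ch (symb (p.restrict (d.out⁻¹ • q))) h =
          (∑ g : G with DoubleCoset.mk q.H p.H g = d, S g) * p.χ h := by
      intro d
      have hd : DoubleCoset.mk q.H p.H d.out = d := DoubleCoset.out_eq' _ _ d
      have h1 : ∑ g : G with DoubleCoset.mk q.H p.H g = d, S g =
          Nat.card {x : G // DoubleCoset.mk q.H p.H x = d} * S d.out := by
        rw [Finset.sum_congr rfl (g := fun _ => S d.out)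
          (fun g hg => hS _ _ ((Finset.mem_filter.1 hg).2.trans hd.symm)), Finset.sum_const,
          nsmul_eq_mul, Nat.card_eq_fintype_card, Fintype.card_subtype]
      have h2 := card_fiber q p d.out
      rw [hd] at h2
      have h3 : ch (symb (p.restrict (d.out⁻¹ • q))) h =
          (Nat.card ((d.out⁻¹ • q).meet p).H : ℂ)⁻¹ * (S d.out * p.χ h) := by
        rw [ch_symb, card_restrict, Finset.sum_mul]
        congr 1
        refine Finset.sum_congr rfl fun t _ => ?_
        have h4 : p.χ (t * h * t⁻¹) = p.χ h := by
          rw [map_mul, map_mul, map_inv, mul_comm, inv_mul_cancel_left]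
        rw [ev_restrict, h4, ev_smul]
        congr 2
        push_cast
        group
      have h5 := card_cast_ne_zero ((d.out⁻¹ • q).meet p).H
      rw [h3, h1, ← Nat.cast_mul, ← h2]
      push_cast
      field_simp
    have htot : ∑ g : G, S g = Nat.card p.H * ∑ g : G, F g := by
      simp only [S]
      have h8 : ∀ t : p.H, ∑ g : G, F (g * t) = ∑ g : G, F g := fun t =>
        Fintype.sum_equiv (Equiv.mulRight (t : G)) _ _ fun g => rfl
      rw [Finset.sum_comm]
      simp only [h8, Finset.sum_const, nsmul_eq_mul, Finset.card_univ, Nat.card_eq_fintype_card]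
    have h6 := card_cast_ne_zero p.H
    have h7 := card_cast_ne_zero q.H
    apply mul_left_cancel₀ (mul_ne_zero h7 h6)
    rw [map_sum, Finset.sum_apply, Finset.mul_sum, Finset.sum_congr rfl fun d _ => hterm d,
      ← Finset.sum_mul,
      Finset.sum_fiberwise Finset.univ (fun g => DoubleCoset.mk q.H p.H g) S, htot, ch_symb]
    simp only [F]
    field_simp

/-- The projection formula `x · Ind χ = Ind (Res x · χ)`. -/
theorem exists_ind_eq_mul (x : MonomialRing G) (p : MonomialPair G) :
    ∃ z : MonomialRing p.H, ind p.H z = x * symb p ∧ ∀ h : p.H, ch z h = ch x h * p.χ h := by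
  induction x using symb_induction with
  | h0 => exact ⟨0, by simp, by simp⟩
  | hof q => exact exists_ind_eq_symb_mul q p
  | hneg x hx =>
    obtain ⟨z, h1, h2⟩ := hx
    exact ⟨-z, by rw [map_neg, h1, neg_mul], fun h => by simp [h2]⟩
  | hadd x y hx hy =>
    obtain ⟨z, h1, h2⟩ := hx
    obtain ⟨w, h3, h4⟩ := hy
    exact ⟨z + w, by rw [map_add, h1, h3, add_mul], fun h => by simp [h2, h4, add_mul]⟩

/-- The element `z` of the projection formula has character `Res (ch x) · χ`, which vanishes along
with `ch x`. -/
theorem mul_symb_mem_map_ind {x : MonomialRing G} (hx : x ∈ relations G) (p : MonomialPair G) :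
    x * symb p ∈ (relations p.H).map (ind p.H) := by
  obtain ⟨z, h1, h2⟩ := exists_ind_eq_mul x p
  refine ⟨z, mem_relations.2 ?_, h1⟩
  ext h
  rw [h2, mem_relations.1 hx]
  simp

theorem ind_mem_relations (H : Subgroup G) {x : MonomialRing H} (hx : x ∈ relations H) :
    ind H x ∈ relations G := by
  classical
  let _ : Fintype G := Fintype.ofFinite G
  rw [mem_relations] at hx ⊢
  ext g
  rw [ch_ind, hx]
  simp

theorem ch_infl (N : Subgroup G) [N.Normal] (x : MonomialRing (G ⧸ N)) (g : G) :
    ch (infl N x) g = ch x (g : G ⧸ N) := by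
  induction x using symb_induction with
  | h0 => simp
  | hof p =>
    rw [infl_symb, ch_symb_comap _ (QuotientGroup.mk'_surjective N)]
    rfl
  | hneg x hx => simp [hx]
  | hadd x y hx hy => simp [hx, hy]

theorem infl_mem_relations (N : Subgroup G) [N.Normal] {x : MonomialRing (G ⧸ N)}
    (hx : x ∈ relations (G ⧸ N)) : infl N x ∈ relations G := by
  rw [mem_relations] at hx ⊢
  ext g
  rw [ch_infl, hx]
  rfl

/-- Induction and inflation preserve the vanishing of characters, and multiplicativity of `ch`
absorbs the factor from `D(G)`. -/
theorem imprimitive_le_relations : imprimitive G ≤ relations G := by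
  refine Submodule.mul_le.2 fun d _ x hx => ?_
  have : x ∈ relations G := by
    refine (sup_le (iSup₂_le fun H _ => ?_) (iSup_le fun N => iSup₂_le fun hN _ => ?_) :
      _ ≤ relations G) hx
    · exact Submodule.map_le_iff_le_comap.2 fun x hx => ind_mem_relations H hx
    · have := hN
      exact Submodule.map_le_iff_le_comap.2 fun x hx => infl_mem_relations N hx
  rw [mem_relations] at this ⊢
  rw [ch_mul, this, mul_zero]

variable (G) in
/-- The subgroup of `M(G)` generated by the symbols `[H, χ]` with `H` a proper subgroup. -/
def properSpan : Submodule ℤ (MonomialRing G) :=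
  Submodule.span ℤ {x | ∃ p : MonomialPair G, p.H ≠ ⊤ ∧ symb p = x}

theorem symb_mem_properSpan {p : MonomialPair G} (hp : p.H ≠ ⊤) : symb p ∈ properSpan G :=
  Submodule.subset_span ⟨p, hp, rfl⟩

theorem infl_mem_properSpan (N : Subgroup G) [N.Normal] {x : MonomialRing (G ⧸ N)}
    (hx : x ∈ properSpan (G ⧸ N)) : infl N x ∈ properSpan G := by
  refine (Submodule.span_le.2 ?_ : properSpan _ ≤ (properSpan G).comap (infl N)) hx
  rintro _ ⟨p, hp, rfl⟩
  rw [SetLike.mem_coe, Submodule.mem_comap, infl_symb]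
  exact symb_mem_properSpan (comap_ne_top (QuotientGroup.mk'_surjective N) hp)

theorem map_ind_le_imprimitive {H : Subgroup G} (hH : H ≠ ⊤) :
    (relations H).map (ind H) ≤ imprimitive G := by
  intro x hx
  rw [← one_mul x]
  exact Submodule.mul_mem_mul (one_mem (linearSubalgebra G))
    (Submodule.mem_sup_left (Submodule.mem_iSup_of_mem H
      (Submodule.mem_iSup_of_mem (lt_top_iff_ne_top.2 hH) hx)))

theorem mul_mem_imprimitive_of_mem_properSpan {x y : MonomialRing G} (hx : x ∈ relations G)
    (hy : y ∈ properSpan G) : x * y ∈ imprimitive G := by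
  refine (Submodule.span_le.2 ?_ :
    properSpan G ≤ (imprimitive G).comap (LinearMap.mulLeft ℤ x)) hy
  rintro _ ⟨p, hp, rfl⟩
  exact map_ind_le_imprimitive hp (mul_symb_mem_map_ind hx p)

/-- A symbol `[G, χ]` is absorbed by `D(G)`; for a symbol of a proper subgroup, the projection
formula turns the product into an induced relation. Hence the product with any element of `M(G)` is
imprimitive. -/
theorem mul_infl_mem_imprimitive {N : Subgroup G} [N.Normal] (hN : N ≠ ⊥)
    {z : MonomialRing (G ⧸ N)} (hz : z ∈ relations (G ⧸ N)) (x : MonomialRing G) :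
    x * infl N z ∈ imprimitive G := by
  induction x using symb_induction with
  | h0 => simp
  | hof p =>
    by_cases hp : p.H = ⊤
    · obtain ⟨χ, hχ⟩ : ∃ χ : G →* ℂˣ, full χ = p := by
        obtain ⟨H, χ⟩ := p
        obtain rfl : H = ⊤ := hp
        exact ⟨χ.comp Subgroup.topEquiv.symm.toMonoidHom, rfl⟩
      rw [← hχ]
      refine Submodule.mul_mem_mul (Algebra.subset_adjoin ⟨χ, rfl⟩) (Submodule.mem_sup_right ?_)
      exact Submodule.mem_iSup_of_mem N (Submodule.mem_iSup_of_mem ‹_›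
        (Submodule.mem_iSup_of_mem hN (Submodule.mem_map_of_mem hz)))
    · rw [mul_comm]
      exact map_ind_le_imprimitive hp (mul_symb_mem_map_ind (infl_mem_relations N hz) p)
  | hneg x hx => rw [neg_mul]; exact neg_mem hx
  | hadd x y hx hy => rw [add_mul]; exact add_mem hx hy

/-- In `x = x · Inf (1 - y) + x · Inf y` the first term contains an inflated relation, and the
second is a relation times symbols of proper subgroups. -/
theorem relations_le_imprimitive {N : Subgroup G} [N.Normal] (hN : N ≠ ⊥)
    (h : ∃ y ∈ properSpan (G ⧸ N), ch y = 1) : relations G ≤ imprimitive G := by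
  intro x hx
  obtain ⟨y, hy, hy1⟩ := h
  have h1 : (1 - y) ∈ relations (G ⧸ N) := by
    rw [mem_relations, map_sub, ch_one, hy1, sub_self]
  have hone : infl N (1 : MonomialRing (G ⧸ N)) = 1 := infl_symb N _
  have h2 : x = x * infl N (1 - y) + x * infl N y := by
    rw [map_sub, hone, mul_sub, mul_one, sub_add_cancel]
  rw [h2]
  exact add_mem (mul_infl_mem_imprimitive hN h1 x)
    (mul_mem_imprimitive_of_mem_properSpan hx (infl_mem_properSpan N hy))

end MonomialRing

/-! ### Groups that are not hyperelementary: permutation characters -/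

/-- A finite group is `p`-hyperelementary if it has a normal cyclic subgroup of order prime to `p`
and of `p`-power index. -/
def IsHyperelementary (p : ℕ) (G : Type u) [Group G] : Prop :=
  ∃ C : Subgroup G, C.Normal ∧ IsCyclic C ∧ p.Coprime (Nat.card C) ∧ ∃ k, C.index = p ^ k

namespace MonomialPair

variable {G : Type u} [Group G]

/-- The pair `(H, 1)`. -/
def triv (H : Subgroup G) : MonomialPair G where
  H := H
  χ := 1

theorem ev_triv_of_mem {H : Subgroup G} {g : G} (h : g ∈ H) : (triv H).ev g = 1 :=
  ev_of_mem (triv H) h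

theorem ev_triv_of_notMem {H : Subgroup G} {g : G} (h : g ∉ H) : (triv H).ev g = 0 :=
  ev_of_notMem (triv H) h

end MonomialPair

namespace MonomialRing

variable {G : Type u} [Group G] [Finite G]

theorem ch_symb_conj (p : MonomialPair G) (t g : G) :
    ch (symb p) (t * g * t⁻¹) = ch (symb p) g := by
  let _ : Fintype G := Fintype.ofFinite G
  rw [ch_symb, ch_symb]
  congr 1
  refine Fintype.sum_equiv (Equiv.mulRight t) _ _ fun s => ?_
  congr 1
  simp only [Equiv.coe_mulRight]
  group

/-- The character of a permutation representation counts fixed points. -/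
theorem ch_triv (H : Subgroup G) (g : G) :
    ch (symb (triv H)) g = Nat.card {x : G ⧸ H // g • x = x} := by
  classical
  let _ : Fintype G := Fintype.ofFinite G
  have h1 : ∀ t : G, (triv H).ev (t * g * t⁻¹) =
      if g • ((t⁻¹ : G) : G ⧸ H) = (t⁻¹ : G) then 1 else 0 := by
    intro t
    have h2 : g • ((t⁻¹ : G) : G ⧸ H) = (t⁻¹ : G) ↔ t * g * t⁻¹ ∈ H := by
      rw [eq_comm, MulAction.Quotient.smul_coe, QuotientGroup.eq]
      simp [mul_assoc]
    split_ifs with h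
    · exact ev_triv_of_mem (h2.1 h)
    · exact ev_triv_of_notMem fun h' => h (h2.2 h')
  have h3 : ∑ t : G, (if g • ((t⁻¹ : G) : G ⧸ H) = (t⁻¹ : G) then (1 : ℂ) else 0) =
      Nat.card H * Nat.card {x : G ⧸ H // g • x = x} := by
    have h4 := QuotientGroup.card_preimage_mk H {x : G ⧸ H | g • x = x}
    have h5 : ∑ t : G, (if g • ((t⁻¹ : G) : G ⧸ H) = (t⁻¹ : G) then (1 : ℂ) else 0) =
        ∑ t : G, if g • (t : G ⧸ H) = t then (1 : ℂ) else 0 :=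
      Fintype.sum_equiv (Equiv.inv G) _ _ fun t => rfl
    rw [h5, Finset.sum_boole]
    rw [← Fintype.card_subtype, ← Nat.card_eq_fintype_card, ← Nat.cast_mul]
    exact congrArg Nat.cast h4
  rw [ch_symb]
  simp only [h1, h3]
  exact inv_mul_cancel_left₀ (card_cast_ne_zero H) _

/-- `properSpan G` is an ideal: the projection formula writes a product with `[H, χ]` as an element
induced from `H`, whose symbols all live on subgroups of `H`. -/
theorem mul_mem_properSpan (x : MonomialRing G) {y : MonomialRing G} (hy : y ∈ properSpan G) :
    x * y ∈ properSpan G := by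
  refine (Submodule.span_le.2 ?_ :
    properSpan G ≤ (properSpan G).comap (LinearMap.mulLeft ℤ x)) hy
  rintro _ ⟨p, hp, rfl⟩
  obtain ⟨z, hz, -⟩ := exists_ind_eq_mul x p
  change x * symb p ∈ properSpan G
  rw [← hz]
  clear hz
  induction z using symb_induction with
  | h0 => simp
  | hof q =>
    rw [ind_symb]
    refine symb_mem_properSpan fun h => hp ?_
    rw [eq_top_iff, ← h]
    exact fun y hy => ((mem_ofSubgroup _ _ _).1 hy).1
  | hneg x hx => rw [map_neg]; exact neg_mem hx
  | hadd x y hx hy => rw [map_add]; exact add_mem hx hy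

variable (G) in
/-- The integer valued characters of elements of `properSpan G`. -/
def properIntChars : AddSubgroup (G → ℤ) where
  carrier := {f | ∃ y ∈ properSpan G, ∀ g, ch y g = f g}
  zero_mem' := ⟨0, zero_mem _, by simp⟩
  add_mem' := fun ⟨y, hy, h⟩ ⟨z, hz, h'⟩ => ⟨y + z, add_mem hy hz, by simp [h, h']⟩
  neg_mem' := fun ⟨y, hy, h⟩ => ⟨-y, neg_mem hy, by simp [h]⟩

theorem mul_mem_properIntChars {f f' : G → ℤ} (hf : f ∈ properIntChars G)
    (hf' : f' ∈ properIntChars G) : f * f' ∈ properIntChars G := by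
  obtain ⟨y, hy, h⟩ := hf
  obtain ⟨z, hz, hzf⟩ := hf'
  exact ⟨y * z, mul_mem_properSpan y hz, by simp [ch_mul, h, hzf]⟩

/-- Banaschewski's criterion: a ring of integer valued functions contains `1` if at each point and
for each prime it has a member whose value is not divisible by the prime. -/
theorem exists_ch_eq_one_of_forall_prime
    (h : ∀ (x : G) (p : ℕ), p.Prime → ∃ f ∈ properIntChars G, ¬ (p : ℤ) ∣ f x) :
    ∃ y ∈ properSpan G, ch y = 1 := by
  classical
  let _ : Fintype G := Fintype.ofFinite G
  -- The values at `x` form a subgroup `aℤ`, and by hypothesis no prime divides `a`.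
  have h1 : ∀ x : G, ∃ f ∈ properIntChars G, f x = 1 := by
    intro x
    obtain ⟨a, ha⟩ := Int.subgroup_cyclic ((properIntChars G).map (Pi.evalAddMonoidHom _ x))
    have hdvd : ∀ f ∈ properIntChars G, a ∣ f x := by
      intro f hf
      have : f x ∈ (properIntChars G).map (Pi.evalAddMonoidHom _ x) := ⟨f, hf, rfl⟩
      rw [ha, ← AddSubgroup.zmultiples_eq_closure, Int.mem_zmultiples_iff] at this
      exact this
    have hunit : a.natAbs = 1 := by
      by_contra hne
      obtain ⟨p, hp, hpa⟩ := Nat.exists_prime_and_dvd hne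
      obtain ⟨f, hf, hfp⟩ := h x p hp
      exact hfp ((Int.natCast_dvd.2 hpa).trans (hdvd f hf))
    have : (1 : ℤ) ∈ (properIntChars G).map (Pi.evalAddMonoidHom _ x) := by
      rw [ha, ← AddSubgroup.zmultiples_eq_closure, Int.mem_zmultiples_iff]
      exact (Int.isUnit_iff_natAbs_eq.2 hunit).dvd
    obtain ⟨f, hf, hf1⟩ := this
    exact ⟨f, hf, hf1⟩
  have h2 : ∀ s : Finset G, ∃ f ∈ properIntChars G, ∀ x ∈ s, f x = 1 := by
    intro s
    induction s using Finset.induction_on with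
    | empty => exact ⟨0, zero_mem _, by simp⟩
    | insert a s _ ih =>
      obtain ⟨f, hf, hfs⟩ := ih
      obtain ⟨f', hf', hfa⟩ := h1 a
      -- This is `1 - (1 - f)(1 - f')`, equal to `1` wherever `f` or `f'` is.
      refine ⟨f + f' - f * f', sub_mem (add_mem hf hf') (mul_mem_properIntChars hf hf'), ?_⟩
      intro x hx
      rcases Finset.mem_insert.1 hx with rfl | hx
      · simp [hfa]
      · simp [hfs x hx]
  obtain ⟨f, ⟨y, hy, hyf⟩, hf⟩ := h2 Finset.univ
  exact ⟨y, hy, funext fun g => by rw [hyf, hf g (Finset.mem_univ g)]; simp⟩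

theorem triv_mem_properIntChars {H : Subgroup G} (hH : H ≠ ⊤) :
    (fun g => (Nat.card {x : G ⧸ H // g • x = x} : ℤ)) ∈ properIntChars G :=
  ⟨symb (triv H), symb_mem_properSpan (p := triv H) hH, fun g => by rw [ch_triv]; simp⟩

/-- An element of `p`-power order has, modulo `p`, as many fixed points on the cosets of a Sylow
`p`-subgroup as there are cosets. -/
theorem not_dvd_card_fixed_sylow {p : ℕ} [Fact p.Prime] (S : Sylow p G) {x : G}
    (hx : IsPGroup p (Subgroup.zpowers x)) :
    ¬ p ∣ Nat.card {y : G ⧸ (S : Subgroup G) // x • y = y} := by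
  have h1 := hx.card_modEq_card_fixedPoints (G ⧸ (S : Subgroup G))
  have h2 : Nat.card (MulAction.fixedPoints (Subgroup.zpowers x) (G ⧸ (S : Subgroup G))) =
      Nat.card {y : G ⧸ (S : Subgroup G) // x • y = y} := by
    refine Nat.card_congr (Equiv.subtypeEquivRight fun y => ?_)
    constructor
    · exact fun h => h ⟨x, Subgroup.mem_zpowers x⟩
    · intro h g
      have : Subgroup.zpowers x ≤ MulAction.stabilizer G y := by
        rw [Subgroup.zpowers_le]
        exact h
      exact this g.2
  rw [h2] at h1
  intro h
  exact S.not_dvd_index ((Nat.modEq_zero_iff_dvd.1 (h1.trans (Nat.modEq_zero_iff_dvd.2 h))))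

/-- The `p`-local step of the hyperelementary induction theorem. -/
theorem exists_properIntChars_not_dvd {p : ℕ} (hp : p.Prime) (hG : ¬ IsHyperelementary p G)
    (x : G) : ∃ f ∈ properIntChars G, ¬ (p : ℤ) ∣ f x := by
  classical
  have : Fact p.Prime := ⟨hp⟩
  let _ : Fintype G := Fintype.ofFinite G
  -- `C` is the `p'`-part of `⟨x⟩` and `N` its normalizer. The subgroup used is the preimage in `N`
  -- of a Sylow `p`-subgroup `S` of `N/C` containing the image of `x`, a `p`-element.
  obtain ⟨a, m, hm, ham⟩ := Nat.exists_eq_pow_mul_and_not_dvd (orderOf_pos x).ne' p hp.ne_one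
  let c := x ^ p ^ a
  have hc : orderOf c = m := by
    rw [orderOf_pow_of_dvd (pow_ne_zero _ hp.ne_zero) (ham ▸ dvd_mul_right _ _), ham,
      Nat.mul_div_cancel_left _ (pow_pos hp.pos a)]
  have hcop : p.Coprime m := (Nat.Prime.coprime_iff_not_dvd hp).2 hm
  let C := Subgroup.zpowers c
  let N := Subgroup.normalizer (C : Set G)
  let C' := C.subgroupOf N
  have hxN : x ∈ N := by
    refine Subgroup.mem_normalizer_fintype ?_
    rintro _ ⟨n, rfl⟩
    have h : Commute x (c ^ n) := ((Commute.refl x).pow_right _).zpow_right n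
    change x * c ^ n * x⁻¹ ∈ C
    rw [h.eq, mul_inv_cancel_right]
    exact ⟨n, rfl⟩
  let B := N ⧸ C'
  let π : N →* B := QuotientGroup.mk' C'
  have hπ : Function.Surjective π := QuotientGroup.mk'_surjective C'
  have hmemC : ∀ y : N, π y = 1 ↔ (y : G) ∈ C := fun y => by
    rw [QuotientGroup.mk'_apply, QuotientGroup.eq_one_iff]
    rfl
  have hxp : IsPGroup p (Subgroup.zpowers (π ⟨x, hxN⟩)) := by
    rintro ⟨_, n, rfl⟩
    refine ⟨a, Subtype.ext ?_⟩
    have h : π ⟨x, hxN⟩ ^ p ^ a = 1 := by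
      rw [← map_pow, hmemC]
      exact Subgroup.mem_zpowers c
    change (π ⟨x, hxN⟩ ^ n) ^ p ^ a = 1
    rw [← zpow_natCast, zpow_comm, zpow_natCast, h, one_zpow]
  obtain ⟨S, hS⟩ := hxp.exists_le_sylow
  let P : MonomialPair N := (triv (S : Subgroup B)).comap π
  let q : MonomialPair G := P.ofSubgroup N
  -- Otherwise `C` is normal in `G` with a `p`-group as quotient, so `G` is `p`-hyperelementary.
  have hqtop : q.H ≠ ⊤ := by
    intro htop
    have hN : ∀ g : G, g ∈ N := fun g =>
      ((mem_ofSubgroup N P g).1 (htop ▸ Subgroup.mem_top g)).1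
    have hSB : ∀ b : B, b ∈ S := by
      intro b
      obtain ⟨y, rfl⟩ := hπ b
      exact ((mem_ofSubgroup N P y).1 (htop ▸ Subgroup.mem_top (y : G))).2
    have hNtop : N = ⊤ := eq_top_iff.2 fun g _ => hN g
    refine hG ⟨C, Subgroup.normalizer_eq_top_iff.1 hNtop, inferInstance, ?_, ?_⟩
    · rwa [Nat.card_zpowers, hc]
    · have h1 : IsPGroup p B := (S.2.of_equiv (Subgroup.topEquiv.symm.trans
        (MulEquiv.subgroupCongr (eq_top_iff.2 fun b _ => hSB b).symm)).symm)
      obtain ⟨k, hk⟩ := IsPGroup.iff_card.1 h1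
      refine ⟨k, ?_⟩
      rw [← hk, ← Subgroup.relIndex_top_right, ← hNtop]
      rfl
  refine ⟨_, triv_mem_properIntChars hqtop, ?_⟩
  -- Some `p`-power of `t c t⁻¹` lies in `C`. Its order `m` is prime to `p`, so `t c t⁻¹` is a power
  -- of that element and lies in `C` too; hence `t` normalizes `C`.
  have hconj : ∀ t : G, ∀ h : t * x * t⁻¹ ∈ N, π ⟨_, h⟩ ∈ S → t ∈ N := by
    intro t h hS
    obtain ⟨k, hk⟩ := S.2 ⟨_, hS⟩
    have hk' : π ⟨_, h⟩ ^ p ^ k = 1 := congrArg Subtype.val hk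
    rw [← map_pow, hmemC] at hk'
    have hyk : (t * x * t⁻¹) ^ p ^ k ∈ C := hk'
    have hd : t * c * t⁻¹ = (t * x * t⁻¹) ^ p ^ a := conj_pow.symm
    have hdk : (t * c * t⁻¹) ^ p ^ k ∈ C := by
      rw [hd, pow_right_comm]
      exact pow_mem hyk _
    have hord : orderOf (t * c * t⁻¹) = m := by
      rw [← hc]
      exact orderOf_injective (MulAut.conj t).toMonoidHom (MulAut.conj t).injective c
    have htc : t * c * t⁻¹ ∈ C := by
      obtain ⟨l, hl⟩ := exists_pow_eq_self_of_coprime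
        (x := t * c * t⁻¹) (n := p ^ k) (hord ▸ hcop.pow_left k)
      rw [← hl]
      exact pow_mem hdk l
    refine Subgroup.mem_normalizer_fintype ?_
    rintro _ ⟨n, rfl⟩
    change t * c ^ n * t⁻¹ ∈ C
    rw [← conj_zpow]
    exact zpow_mem htc n
  -- By `hconj` only `t` in `N` contribute to the induced character at `x`, so the value can be read
  -- off in `N/C`.
  have hval : ch (symb q) x = ch (symb (triv (S : Subgroup B))) (π ⟨x, hxN⟩) := by
    let _ : Fintype N := Fintype.ofFinite N
    have h1 : ∀ t : G, (if h : t * x * t⁻¹ ∈ N then ch (symb P) ⟨_, h⟩ else 0) =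
        if t ∈ N then ch (symb P) ⟨x, hxN⟩ else 0 := by
      intro t
      by_cases ht : t ∈ N
      · rw [if_pos ht, dif_pos (N.mul_mem (N.mul_mem ht hxN) (N.inv_mem ht))]
        exact ch_symb_conj P ⟨t, ht⟩ ⟨x, hxN⟩
      · rw [if_neg ht]
        split_ifs with h
        · rw [ch_symb]
          refine mul_eq_zero_of_right _ (Finset.sum_eq_zero fun s _ => ?_)
          refine ev_of_notMem P fun hs => ht ?_
          have h2 : (s : G) * t * x * (s * t)⁻¹ = (s * ⟨t * x * t⁻¹, h⟩ * s⁻¹ : N) := by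
            push_cast
            group
          have h3 : (s : G) * t ∈ N := hconj _ (h2 ▸ SetLike.coe_mem _) (by
            simp only [h2]
            exact hs)
          exact (N.mul_mem_cancel_left s.2).1 h3
        · rfl
    rw [← ind_symb, ch_ind, ← ch_symb_comap π hπ]
    simp only [h1]
    rw [Finset.sum_ite, Finset.sum_const_zero, add_zero, Finset.sum_const, nsmul_eq_mul,
      ← Fintype.card_subtype, ← Nat.card_eq_fintype_card]
    exact inv_mul_cancel_left₀ (card_cast_ne_zero N) _
  have hcard : Nat.card {y : G ⧸ q.H // x • y = y} =
      Nat.card {y : B ⧸ (S : Subgroup B) // π ⟨x, hxN⟩ • y = y} := by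
    rw [← Nat.cast_inj (R := ℂ), ← ch_triv, ← ch_triv, ← hval]
    rfl
  intro h
  rw [Int.natCast_dvd_natCast, hcard] at h
  exact not_dvd_card_fixed_sylow S hxp h

end MonomialRing

/-! ### Sums over conjugation orbits as induced characters -/

namespace MonomialRing

variable {G : Type u} [Group G] [Finite G]

/-- If each pair `p = (H, χ)` has `H` as its stabilizer under conjugation, then the character of
`[H, χ]` is the sum of the extensions by zero of the conjugates of `χ`. -/
theorem ch_symb_eq_sum_orbit [DecidableEq (MonomialPair G)] [Fintype G] (p : MonomialPair G)
    (hp : ∀ g, g • p = p → g ∈ p.H) (g : G) :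
    ch (symb p) g = ∑ q ∈ Finset.univ.image (fun t : G => t • p), q.ev g := by
  have h1 : ∑ t : G, p.ev (t * g * t⁻¹) = ∑ t : G, (t • p).ev g :=
    Fintype.sum_equiv (Equiv.inv G) _ _ fun t => by simp [ev_smul]
  have h2 : ∑ t : G, (t • p).ev g =
      ∑ q ∈ Finset.univ.image (fun t : G => t • p), (Nat.card p.H : ℂ) * q.ev g := by
    rw [Finset.sum_comp (fun q : MonomialPair G => q.ev g) (fun t : G => t • p)]
    refine Finset.sum_congr rfl fun q hq => ?_
    obtain ⟨s, -, rfl⟩ := Finset.mem_image.1 hq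
    rw [nsmul_eq_mul, ← Fintype.card_subtype, ← Nat.card_eq_fintype_card]
    -- The elements carrying `p` to a given conjugate form a coset of the stabilizer of `p`, which
    -- is `H`; each conjugate is thus hit `|H|` times.
    congr 2
    refine Nat.card_congr ⟨fun t => ⟨s⁻¹ * t, hp _ ?_⟩, fun h => ⟨s * h, ?_⟩, ?_, ?_⟩
    · rw [mul_smul, t.2, inv_smul_smul]
    · rw [mul_smul, smul_self_of_mem p h.2]
    · intro t
      simp
    · intro h
      simp
  rw [ch_symb, h1, h2, ← Finset.mul_sum, inv_mul_cancel_left₀ (card_cast_ne_zero _)]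

/-- A conjugation-stable set is a union of orbits, and each orbit sum is the character of a single
symbol; orbits are removed one at a time. -/
theorem exists_ch_eq_sum (s : Finset (MonomialPair G)) (hs : ∀ g : G, ∀ p ∈ s, g • p ∈ s)
    (hstab : ∀ p ∈ s, ∀ g : G, g • p = p → g ∈ p.H) (htop : ∀ p ∈ s, p.H ≠ ⊤) :
    ∃ y ∈ properSpan G, ∀ g, ch y g = ∑ p ∈ s, p.ev g := by
  classical
  let _ : Fintype G := Fintype.ofFinite G
  induction s using Finset.strongInduction with
  | H s ih =>
    rcases s.eq_empty_or_nonempty with rfl | ⟨p, hp⟩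
    · exact ⟨0, zero_mem _, by simp⟩
    · have hsub : Finset.univ.image (fun t : G => t • p) ⊆ s :=
        Finset.image_subset_iff.2 fun t _ => hs t p hp
      have hpO : p ∈ Finset.univ.image (fun t : G => t • p) :=
        Finset.mem_image.2 ⟨1, Finset.mem_univ _, one_smul _ _⟩
      obtain ⟨y, hy, hyc⟩ := ih (s \ Finset.univ.image (fun t : G => t • p))
        (Finset.sdiff_ssubset hsub ⟨p, hpO⟩)
        (fun g q hq => by
          rw [Finset.mem_sdiff] at hq ⊢
          refine ⟨hs g q hq.1, fun h => hq.2 ?_⟩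
          obtain ⟨t, -, ht⟩ := Finset.mem_image.1 h
          refine Finset.mem_image.2 ⟨g⁻¹ * t, Finset.mem_univ _, ?_⟩
          rw [mul_smul, show t • p = g • q from ht, inv_smul_smul])
        (fun q hq => hstab q (Finset.mem_sdiff.1 hq).1)
        (fun q hq => htop q (Finset.mem_sdiff.1 hq).1)
      refine ⟨y + symb p, add_mem hy (symb_mem_properSpan (htop p hp)), fun g => ?_⟩
      rw [map_add, Pi.add_apply, hyc, ch_symb_eq_sum_orbit p (hstab p hp),
        Finset.sum_sdiff hsub]

end MonomialRing

/-! ### Semidirect products `A ⋊ P` with `A` abelian -/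

section Characters

variable {A : Type u} [CommGroup A] [Finite A]

open scoped Classical in
/-- Orthogonality relations for the characters of `A` trivial on `Z`. -/
theorem card_mul_sum_characters_apply [Fintype (A →* ℂˣ)] (Z : Subgroup A) (a : A) :
    (Nat.card Z : ℂ) * ∑ χ : A →* ℂˣ with (∀ z ∈ Z, χ z = 1), (χ a : ℂ) =
      if a ∈ Z then (Nat.card A : ℂ) else 0 := by
  split_ifs with ha
  · have h1 : ∀ χ : A →* ℂˣ, χ ∈ (MonoidHom.domRestrictHom Z ℂˣ).ker ↔ ∀ z ∈ Z, χ z = 1 := by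
      intro χ
      rw [MonoidHom.mem_ker, MonoidHom.ext_iff]
      exact ⟨fun h z hz => h ⟨z, hz⟩, fun h z => h z z.2⟩
    have h2 := CommGroup.card_domRestrictHom_ker (M := ℂ) Z
    rw [Nat.card_congr (Equiv.subtypeEquivRight h1), Nat.card_eq_fintype_card,
      Fintype.card_subtype] at h2
    rw [Finset.sum_congr rfl (g := fun _ => (1 : ℂ))
      fun χ hχ => by rw [(Finset.mem_filter.1 hχ).2 a ha, Units.val_one],
      Finset.sum_const, h2, nsmul_eq_mul, mul_one, ← Nat.cast_mul, mul_comm,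
      ← Z.card_eq_card_quotient_mul_card_subgroup]
  -- Multiplication by `ψ` permutes the characters trivial on `Z` and scales the sum by `ψ a ≠ 1`,
  -- so the sum is zero.
  · obtain ⟨ψ, hψ, hψa⟩ : ∃ ψ : A →* ℂˣ, (∀ z ∈ Z, ψ z = 1) ∧ ψ a ≠ 1 := by
      by_contra! h
      exact ha ((CommGroup.forall_monoidHom_apply_eq_one_iff (M := ℂ) Z a).1 h)
    apply mul_eq_zero_of_right
    have h1 : (ψ a : ℂ) * ∑ χ : A →* ℂˣ with (∀ z ∈ Z, χ z = 1), (χ a : ℂ) =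
        ∑ χ : A →* ℂˣ with (∀ z ∈ Z, χ z = 1), (χ a : ℂ) := by
      rw [Finset.mul_sum]
      refine Finset.sum_equiv (Equiv.mulLeft ψ) (fun χ => ?_) fun χ _ => ?_
      · simp only [Finset.mem_filter, Finset.mem_univ, true_and, Equiv.coe_mulLeft]
        refine forall₂_congr fun z hz => ?_
        rw [MonoidHom.mul_apply, hψ z hz, one_mul]
      · simp
    by_contra hne
    exact hψa (Units.ext (mul_right_cancel₀ hne (h1.trans (one_mul _).symm)))

end Characters

namespace SemidirectProduct

variable {A P : Type u} [CommGroup A] [Group P] (φ : P →* MulAut A)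

/-- The subgroup of elements of `A` fixed by `P`. -/
def fixed : Subgroup A where
  carrier := {a | ∀ q, φ q a = a}
  mul_mem' ha hb q := by rw [map_mul, ha q, hb q]
  one_mem' q := map_one _
  inv_mem' ha q := by rw [map_inv, ha q]

theorem apply_mem_fixed (q : P) (a : A) : φ q a ∈ fixed φ ↔ a ∈ fixed φ := by
  constructor
  · intro h
    have := h q⁻¹
    rw [map_inv, MulAut.inv_apply_self] at this
    rwa [← this] at h
  · intro h
    rwa [h q]

/-- The subgroup `fixed φ ⋊ P` of `A ⋊ P`. -/
def fixedProd : Subgroup (A ⋊[φ] P) where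
  carrier := {t | t.left ∈ fixed φ}
  mul_mem' {s t} hs ht := by
    change s.left * φ s.right t.left ∈ fixed φ
    rw [ht s.right]
    exact mul_mem hs ht
  one_mem' := one_mem (fixed φ)
  inv_mem' {t} ht := by
    change φ t.right⁻¹ t.left⁻¹ ∈ fixed φ
    rw [map_inv, ht]
    exact inv_mem ht

/-- The extension of a character `χ` of `A` to the stabilizer of `χ` in `A ⋊ P`, trivial on the
stabilizer in `P`. -/
def extend (χ : A →* ℂˣ) : MonomialPair (A ⋊[φ] P) where
  H :=
    { carrier := {t | ∀ a, χ (φ t.right a) = χ a}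
      mul_mem' := fun {s t} hs ht a => by
        rw [mul_right, map_mul, MulAut.mul_apply, hs, ht]
      one_mem' := fun a => by simp
      inv_mem' := fun {t} ht a => by
        rw [inv_right, ← ht, map_inv, MulAut.apply_inv_self] }
  χ :=
    { toFun := fun t => χ t.1.left
      map_one' := map_one χ
      map_mul' := fun s t => by
        change χ (s.1.left * φ s.1.right t.1.left) = _
        rw [map_mul, s.2 t.1.left] }

theorem mem_extend (χ : A →* ℂˣ) (t : A ⋊[φ] P) :
    t ∈ (extend φ χ).H ↔ ∀ a, χ (φ t.right a) = χ a := Iff.rfl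

theorem extend_χ (χ : A →* ℂˣ) (t : A ⋊[φ] P) (ht : t ∈ (extend φ χ).H) :
    (extend φ χ).χ ⟨t, ht⟩ = χ t.left := rfl

theorem left_conj (g t : A ⋊[φ] P) :
    (g⁻¹ * t * g).left = φ g.right⁻¹ (g.left⁻¹ * t.left * φ t.right g.left) := by
  simp [mul_assoc]

/-- Conjugation moves `χ` through the `P`-component of `g` alone: on the stabilizer, the two factors
coming from `g.left` cancel. -/
theorem smul_extend (g : A ⋊[φ] P) (χ : A →* ℂˣ) :
    g • extend φ χ = extend φ (χ.comp (φ g.right⁻¹).toMonoidHom) := by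
  have h : ∀ t : A ⋊[φ] P, t ∈ (g • extend φ χ).H ↔
      ∀ a, χ (φ g.right⁻¹ (φ t.right a)) = χ (φ g.right⁻¹ a) := by
    intro t
    rw [mem_smul, mem_extend]
    have h1 : ∀ a, φ (g⁻¹ * t * g).right a = φ g.right⁻¹ (φ t.right (φ g.right a)) := by
      intro a
      simp
    simp only [h1]
    constructor
    · intro h a
      have := h (φ g.right⁻¹ a)
      rwa [show φ g.right (φ g.right⁻¹ a) = a by simp] at this
    · intro h a
      rw [h]
      simp
  refine MonomialPair.ext' h fun t ht ht' => ?_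
  rw [smul_χ, extend_χ, extend_χ, left_conj]
  rw [map_mul, map_mul, map_mul, map_mul, (h t).1 ht, map_inv, map_inv, inv_mul_cancel_comm]
  rfl

theorem extend_injective : Function.Injective (extend φ) := by
  intro χ ψ h
  ext a
  have h1 : ∀ χ : A →* ℂˣ, (extend φ χ).ev (inl a) = χ a := fun χ =>
    ev_of_mem _ ((mem_extend φ χ _).2 fun b => by simp)
  rw [← h1, h, h1]

/-- Supplies the stabilizer condition of `exists_ch_eq_sum`: since `χ` is recovered from its
extension, fixing the pair means fixing `χ`. -/
theorem mem_extend_of_smul_eq {χ : A →* ℂˣ} {g : A ⋊[φ] P} (h : g • extend φ χ = extend φ χ) :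
    g ∈ (extend φ χ).H := by
  rw [smul_extend] at h
  have h1 := extend_injective φ h
  intro a
  have h2 := DFunLike.congr_fun h1 (φ g.right a)
  rw [← h2]
  simp

/-- For a `p`-group acting on an abelian group of order prime to `p`, an invariant character that
is trivial on the fixed points is trivial. -/
theorem eq_one_of_invariant [Finite A] {p : ℕ} [Fact p.Prime] (hP : IsPGroup p P)
    (hA : p.Coprime (Nat.card A)) (χ : A →* ℂˣ) (hfix : ∀ z ∈ fixed φ, χ z = 1)
    (hχ : ∀ q a, χ (φ q a) = χ a) : χ = 1 := by
  ext a
  -- `P` acts on the fibre of `χ` through `a`, a coset of `ker χ`. Its size is prime to `p`, so it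
  -- contains a fixed point, where `χ` is `1`.
  let _ : MulAction P {x // χ x = χ a} :=
    { smul := fun q x => ⟨φ q x, (hχ q x).trans x.2⟩
      one_smul := fun x => Subtype.ext (by change φ 1 x.1 = x; simp)
      mul_smul := fun q r x => Subtype.ext (by change φ (q * r) x.1 = φ q (φ r x); simp) }
  have hcard : Nat.card {x // χ x = χ a} = Nat.card χ.ker := by
    refine Nat.card_congr ⟨fun x => ⟨a⁻¹ * x, ?_⟩, fun x => ⟨a * x, ?_⟩, ?_, ?_⟩
    · rw [MonoidHom.mem_ker, map_mul, x.2, map_inv, inv_mul_cancel]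
    · rw [map_mul, x.2, mul_one]
    · intro x
      simp
    · intro x
      simp
  have hdvd : ¬ p ∣ Nat.card {x // χ x = χ a} := by
    rw [hcard, ← Nat.Prime.coprime_iff_not_dvd Fact.out]
    exact hA.coprime_dvd_right χ.ker.card_subgroup_dvd_card
  obtain ⟨x, hx⟩ := hP.nonempty_fixed_point_of_prime_not_dvd_card _ hdvd
  have : x.1 ∈ fixed φ := fun q => congrArg Subtype.val (hx q)
  rw [← x.2, hfix _ this]
  rfl

-- The map `x ↦ χ (φ g.right x) · (χ x)⁻¹` is a homomorphism on `A`, trivial exactly when `g`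
-- stabilizes `χ`; its sum over `A` is `|A|` or `0` accordingly.
open scoped Classical in
theorem card_mul_ev_extend [Fintype A] (χ : A →* ℂˣ) (g : A ⋊[φ] P) :
    (Nat.card A : ℂ) * (extend φ χ).ev g =
      ∑ x : A, (χ (x⁻¹ * g.left * φ g.right x) : ℂ) := by
  let f : A →* ℂ := (Units.coeHom ℂ).comp ((χ.comp (φ g.right).toMonoidHom) * χ⁻¹)
  have h1 : ∀ x, (χ (x⁻¹ * g.left * φ g.right x) : ℂ) = χ g.left * f x := by
    intro x
    simp [f]
    ring
  have h2 : f = 1 ↔ g ∈ (extend φ χ).H := by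
    rw [mem_extend, MonoidHom.ext_iff]
    refine forall_congr' fun x => ?_
    change ((χ (φ g.right x) * (χ x)⁻¹ : ℂˣ) : ℂ) = 1 ↔ _
    rw [Units.val_eq_one, mul_inv_eq_one]
  simp only [h1]
  rw [← Finset.mul_sum, sum_hom_units]
  by_cases hg : g ∈ (extend φ χ).H
  · rw [if_pos (h2.2 hg), ev_of_mem _ hg, extend_χ, Nat.card_eq_fintype_card, mul_comm]
  · rw [if_neg fun h => hg (h2.1 h), ev_of_notMem _ hg, Nat.cast_zero, mul_zero, mul_zero]

variable [Finite A] [Finite P]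

instance : Finite (A ⋊[φ] P) := Finite.of_equiv _ SemidirectProduct.equivProd.symm

-- Whether `t g t⁻¹` lies in `fixedProd φ` depends only on the `A`-component of `t⁻¹`, so the sum
-- over `P` contributes a factor `|P|` that cancels.
open scoped Classical in
theorem card_mul_ch_fixedProd [Fintype A] (g : A ⋊[φ] P) :
    (Nat.card (fixed φ) : ℂ) * MonomialRing.ch (MonomialRing.symb (triv (fixedProd φ))) g =
      ∑ x : A, if x⁻¹ * g.left * φ g.right x ∈ fixed φ then 1 else 0 := by
  let _ : Fintype P := Fintype.ofFinite P
  let _ : Fintype (A ⋊[φ] P) := Fintype.ofFinite _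
  have hcard : Nat.card (triv (fixedProd φ)).H = Nat.card (fixed φ) * Nat.card P := by
    rw [← Nat.card_prod]
    exact Nat.card_congr ⟨fun t => (⟨t.1.left, t.2⟩, t.1.right), fun z => ⟨⟨z.1, z.2⟩, z.1.2⟩,
      fun _ => rfl, fun _ => rfl⟩
  have h1 : ∑ t : A ⋊[φ] P, (triv (fixedProd φ)).ev (t * g * t⁻¹) =
      ∑ t : A ⋊[φ] P, if t.left⁻¹ * g.left * φ g.right t.left ∈ fixed φ then 1 else 0 := by
    refine Fintype.sum_equiv (Equiv.inv _) _ _ fun t => ?_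
    have h2 : t * g * t⁻¹ ∈ fixedProd φ ↔
        t⁻¹.left⁻¹ * g.left * φ g.right t⁻¹.left ∈ fixed φ := by
      have h3 := left_conj φ t⁻¹ g
      rw [inv_inv] at h3
      change (t * g * t⁻¹).left ∈ fixed φ ↔ _
      rw [h3, apply_mem_fixed]
    rw [Equiv.inv_apply]
    split_ifs with h
    · exact ev_triv_of_mem (h2.2 h)
    · exact ev_triv_of_notMem fun h' => h (h2.1 h')
  have h4 : ∑ t : A ⋊[φ] P, (if t.left⁻¹ * g.left * φ g.right t.left ∈ fixed φ then (1 : ℂ) else 0) =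
      Nat.card P * ∑ x : A, if x⁻¹ * g.left * φ g.right x ∈ fixed φ then 1 else 0 := by
    refine (Fintype.sum_equiv SemidirectProduct.equivProd _
      (fun z : A × P => if z.1⁻¹ * g.left * φ g.right z.1 ∈ fixed φ then (1 : ℂ) else 0)
      fun t => rfl).trans ?_
    rw [Fintype.sum_prod_type]
    rw [Finset.mul_sum, Nat.card_eq_fintype_card]
    refine Finset.sum_congr rfl fun x _ => ?_
    by_cases hx : x⁻¹ * g.left * φ g.right x ∈ fixed φ <;> simp [hx]
  have h5 := MonomialRing.card_cast_ne_zero (fixed φ)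
  have h6 : (Nat.card P : ℂ) ≠ 0 := Nat.cast_ne_zero.2 Nat.card_pos.ne'
  rw [MonomialRing.ch_symb, h1, h4, hcard]
  push_cast
  field_simp

open scoped Classical in
/-- The decomposition of the permutation character on the cosets of `fixed φ ⋊ P`. -/
theorem ch_fixedProd [Fintype (A →* ℂˣ)] (g : A ⋊[φ] P) :
    MonomialRing.ch (MonomialRing.symb (triv (fixedProd φ))) g =
      ∑ χ : A →* ℂˣ with (∀ z ∈ fixed φ, χ z = 1), (extend φ χ).ev g := by
  let _ : Fintype A := Fintype.ofFinite A
  have h5 := MonomialRing.card_cast_ne_zero (fixed φ)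
  have h6 : (Nat.card A : ℂ) ≠ 0 := Nat.cast_ne_zero.2 Nat.card_pos.ne'
  apply mul_left_cancel₀ h6
  apply mul_left_cancel₀ h5
  -- With both sides scaled by `|A|` and `|fixed φ|`, exchanging the sums over `χ` and `x` lets
  -- orthogonality turn the characters into the indicator of `fixed φ`.
  rw [mul_left_comm, card_mul_ch_fixedProd, Finset.mul_sum, Finset.mul_sum]
  simp only [card_mul_ev_extend]
  rw [Finset.sum_comm, Finset.mul_sum]
  simp only [card_mul_sum_characters_apply, mul_ite, mul_one, mul_zero]

/-- In the decomposition `ch_fixedProd` the trivial `χ` contributes the constant `1`. The other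
terms form orbit sums, induced from stabilizers that `hinv` makes proper; subtracting them isolates
`1`. -/
theorem exists_ch_eq_one (hfix : fixed φ ≠ ⊤)
    (hinv : ∀ χ : A →* ℂˣ, (∀ z ∈ fixed φ, χ z = 1) → (∀ q a, χ (φ q a) = χ a) → χ = 1) :
    ∃ y ∈ MonomialRing.properSpan (A ⋊[φ] P), MonomialRing.ch y = 1 := by
  classical
  let _ : Fintype (A →* ℂˣ) := Fintype.ofFinite _
  let s : Finset (A →* ℂˣ) := Finset.univ.filter fun χ => ∀ z ∈ fixed φ, χ z = 1
  have hone : (1 : A →* ℂˣ) ∈ s := Finset.mem_filter.2 ⟨Finset.mem_univ _, fun _ _ => rfl⟩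
  have hs : ∀ p ∈ (s.erase 1).image (extend φ), ∃ χ, χ ≠ 1 ∧ (∀ z ∈ fixed φ, χ z = 1) ∧
      extend φ χ = p := by
    intro p hp
    obtain ⟨χ, hχ, rfl⟩ := Finset.mem_image.1 hp
    exact ⟨χ, (Finset.mem_erase.1 hχ).1, (Finset.mem_filter.1 (Finset.mem_erase.1 hχ).2).2, rfl⟩
  obtain ⟨y, hy, hyc⟩ := MonomialRing.exists_ch_eq_sum ((s.erase 1).image (extend φ))
    (by
      intro g p hp
      obtain ⟨χ, hχ, hχ', rfl⟩ := hs p hp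
      rw [smul_extend]
      refine Finset.mem_image_of_mem _ (Finset.mem_erase.2 ⟨?_, Finset.mem_filter.2
        ⟨Finset.mem_univ _, fun z hz => ?_⟩⟩)
      · intro h
        apply hχ
        ext a
        have := DFunLike.congr_fun h (φ g.right a)
        simpa using congrArg Units.val this
      · change χ (φ g.right⁻¹ z) = 1
        rw [hz, hχ' z hz])
    (by
      intro p hp g hg
      obtain ⟨χ, -, -, rfl⟩ := hs p hp
      exact mem_extend_of_smul_eq φ hg)
    (by
      intro p hp htop
      obtain ⟨χ, hχ, hχ', rfl⟩ := hs p hp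
      refine hχ (hinv χ hχ' fun q a => ?_)
      have : (inr q : A ⋊[φ] P) ∈ (extend φ χ).H := htop ▸ Subgroup.mem_top _
      exact this a)
  refine ⟨MonomialRing.symb (triv (fixedProd φ)) - y,
    sub_mem (MonomialRing.symb_mem_properSpan (p := triv (fixedProd φ)) ?_) hy, ?_⟩
  · intro htop
    refine hfix (eq_top_iff.2 fun a _ => ?_)
    have : (inl a : A ⋊[φ] P) ∈ (triv (fixedProd φ)).H := htop ▸ Subgroup.mem_top _
    exact this
  · ext g
    have h1 : (extend φ 1).ev g = 1 :=
      ev_of_mem _ ((mem_extend φ 1 g).2 fun _ => rfl)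
    rw [map_sub, Pi.sub_apply, ch_fixedProd, hyc,
      Finset.sum_image fun _ _ _ _ h => extend_injective φ h]
    change ∑ χ ∈ s, _ - _ = _
    rw [← Finset.add_sum_erase s _ hone, h1, add_sub_cancel_right]
    rfl

end SemidirectProduct

/-! ### The trivial character of a non-elementary group, and the conclusion -/

namespace MonomialRing

variable {G : Type u} [Group G] [Finite G]

/-- Pull-back keeps subgroups proper and composes characters with `f`. It carries the result for `C
⋊ P` over to an isomorphic group. -/
theorem exists_ch_eq_one_of_surjective {Q : Type u} [Group Q] [Finite Q] (f : G →* Q)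
    (hf : Function.Surjective f) (h : ∃ y ∈ properSpan Q, ch y = 1) :
    ∃ y ∈ properSpan G, ch y = 1 := by
  obtain ⟨y, hy, hy1⟩ := h
  have key : ∃ x ∈ properSpan G, ∀ g, ch x g = ch y (f g) := by
    clear hy1
    induction hy using Submodule.span_induction with
    | mem y hy =>
      obtain ⟨p, hp, rfl⟩ := hy
      exact ⟨_, symb_mem_properSpan (comap_ne_top hf hp), ch_symb_comap f hf p⟩
    | zero => exact ⟨0, zero_mem _, by simp⟩
    | add y z _ _ hy hz =>
      obtain ⟨a, ha, ha'⟩ := hy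
      obtain ⟨b, hb, hb'⟩ := hz
      exact ⟨a + b, add_mem ha hb, by simp [ha', hb']⟩
    | smul n y _ hy =>
      obtain ⟨a, ha, ha'⟩ := hy
      exact ⟨n • a, Submodule.smul_mem _ n ha, fun g => by
        rw [map_zsmul, map_zsmul, Pi.smul_apply, Pi.smul_apply, ha']⟩
  obtain ⟨x, hx, hx1⟩ := key
  exact ⟨x, hx, funext fun g => by rw [hx1, hy1]; rfl⟩

/-- A Sylow `p`-subgroup `P` complements the cyclic normal `p'`-subgroup `C`, so `G ≅ C ⋊ P`. If `P`
fixed all of `C`, this would be `C × P`, an elementary group. -/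
theorem exists_ch_eq_one_of_isHyperelementary {p : ℕ} (hp : p.Prime) (h : IsHyperelementary p G)
    (hG : ¬ IsElementaryGroup G) : ∃ y ∈ properSpan G, ch y = 1 := by
  have : Fact p.Prime := ⟨hp⟩
  obtain ⟨C, hC, hcyc, hcop, k, hk⟩ := h
  obtain ⟨P⟩ : Nonempty (Sylow p G) := inferInstance
  have hPcop : (Nat.card C).Coprime (Nat.card P) := by
    obtain ⟨n, hn⟩ := IsPGroup.iff_card.1 P.2
    rw [hn]
    exact (hcop.pow_left n).symm
  have hcompl : C.IsComplement' P := by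
    refine Subgroup.isComplement'_of_coprime ?_ hPcop
    rw [← C.card_mul_index, hk]
    congr 1
    have h1 : Nat.card G = Nat.card C * p ^ k := by rw [← hk, C.card_mul_index]
    rw [P.card_eq_multiplicity, h1, Nat.factorization_mul Nat.card_pos.ne'
      (pow_ne_zero _ hp.ne_zero)]
    simp [hp.factorization_self, Nat.factorization_eq_zero_of_not_dvd
      ((Nat.Prime.coprime_iff_not_dvd hp).1 hcop)]
  let _ : CommGroup C := IsCyclic.commGroup
  obtain ⟨φ, ⟨e⟩⟩ : ∃ φ : P →* MulAut C, Nonempty (C ⋊[φ] P ≃* G) :=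
    ⟨_, ⟨SemidirectProduct.mulEquivSubgroup hcompl⟩⟩
  refine exists_ch_eq_one_of_surjective e.symm.toMonoidHom e.symm.surjective
    (SemidirectProduct.exists_ch_eq_one φ ?_ fun χ =>
      SemidirectProduct.eq_one_of_invariant φ P.2 hcop χ)
  intro htop
  obtain rfl : φ = 1 := by
    ext q a
    have : a ∈ SemidirectProduct.fixed φ := htop ▸ Subgroup.mem_top a
    exact congrArg Subtype.val (this q)
  exact hG ⟨inferInstance, p, hp, C, P, hcyc, P.2,
    ⟨e.symm.trans SemidirectProduct.mulEquivProd⟩⟩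

/-- If `G` is not elementary, the trivial character is an integral combination of characters
induced from one-dimensional characters of proper subgroups. -/
theorem exists_ch_eq_one (hG : ¬ IsElementaryGroup G) : ∃ y ∈ properSpan G, ch y = 1 := by
  by_cases h : ∃ p : ℕ, p.Prime ∧ IsHyperelementary p G
  · obtain ⟨p, hp, hpG⟩ := h
    exact exists_ch_eq_one_of_isHyperelementary hp hpG hG
  · exact exists_ch_eq_one_of_forall_prime fun x p hp =>
      exists_properIntChars_not_dvd hp (fun h' => h ⟨p, hp, h'⟩) x

end MonomialRing

end

theorem mainTheorem11 {G : Type u} [Group G] [Finite G] (N : Subgroup G) [N.Normal]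
    (hN : N ≠ ⊥) (hGN : ¬ IsElementaryGroup (G ⧸ N)) :
    MonomialRing.imprimitive G ≤ MonomialRing.relations G ∧
      Subsingleton (MonomialRing.PrimitiveQuotient G) := by
  refine ⟨MonomialRing.imprimitive_le_relations, ?_⟩
  rw [Submodule.Quotient.subsingleton_iff, Submodule.submoduleOf_eq_top]
  exact MonomialRing.relations_le_imprimitive hN (MonomialRing.exists_ch_eq_one hGN)
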